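/- Let $\nu\ge 2$ and $k_1,\dots,k_\nu>1$ be integers, and let $\beta_{ij}$ ($1\le i\le\nu$, $1\le j\le k_i$) be positive integers with $\sum_j\beta_{ij}=N$ for every $i$. Let $P=P(\beta)$ be the polytope of real $k_1\times\dots\times k_\nu$ arrays $x=(\xi_{j_1\dots j_\nu})$ with $x\ge 0$ that satisfy the system $Ax=b$ of the $d=k_1+\dots+k_\nu-\nu+1$ equations $$\sum_{j_1,\dots,j_\nu:\ j_i=j}\xi_{j_1\dots j_\nu}=\beta_{ij}\quad(1\le i\le\nu,\ 1\le j\le k_i-1),\qquad \sum_{j_1,\dots,j_\nu}\xi_{j_1\dots j_\nu}=N ,$$ and let $P^{01}=P\cap\{x:\ \xi_{j_1\dots j_\nu}\le 1\text{ for all }j_1,\dots,j_\nu\}$. Integer points of $P$ are the $\nu$-way contingency tables with sectional sums $\beta_{ij}$; 0-1 points of $P$ are the binary ones. Let $a_p$ denote the columns of $A$, $p=(j_1,\dots,j_\nu)$, let $\Lambda=A(\mathbb Z^{k_1\cdots k_\nu})\subset\mathbb Z^d$, and put $$g(x)=\sum_p\bigl((\xi_p+1)\ln(\xi_p+1)-\xi_p\ln\xi_p\bigr),\qquad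 h(x)=\sum_p\Bigl(\xi_p\ln\tfrac1{\xi_p}+(1-\xi_p)\ln\tfrac1{1-\xi_p}\Bigr).$$ For $z=(\zeta_p)$ put $$G(z)=\frac{e^{g(z)}\det\Lambda}{(2\pi)^{d/2}(\det BB^T)^{1/2}},\qquad H(z)=\frac{e^{h(z)}\det\Lambda}{(2\pi)^{d/2}(\det B_{01}B_{01}^T)^{1/2}},$$ where $B$ has columns $(\zeta_p^2+\zeta_p)^{1/2}a_p$ and $B_{01}$ has columns $(\zeta_p-\zeta_p^2)^{1/2}a_p$. Then the following hold. (0) If $\nu\geq 2$ and $k_1=\dots=k_\nu=k>1$, then $\det AA^T=k^{(\nu^2-\nu)(k-1)}$. Now let $\nu\ge5$ be fixed. (1) For all real $c,\delta,\epsilon>0$ and all real $C,M$ there is $n_0$ such that for all $n\ge n_0$, all $k_1,\dots,k_\nu>1$ with $cn\le k_i\le Cn$, and all $\beta$ as above: if $z$ maximizes $g$ on $P$ and $\delta\le\zeta_p\le M$ for all $p$, then $\bigl|\,|P\cap\mathbb Z^{k_1\cdots k_\nu}|/G(z)-1\bigr|\le\epsilon$. (2) For all real $c,\epsilon>0$,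 $0<\delta<1/2$ and all real $C$ there is $n_0$ such that for all $n\ge n_0$, all $k_1,\dots,k_\nu>1$ with $cn\le k_i\le Cn$, and all $\beta$ as above: if $z$ maximizes $h$ on $P^{01}$ and $\delta\le\zeta_p\le1-\delta$ for all $p$, then $\bigl|\,|P\cap\{0,1\}^{k_1\cdots k_\nu}|/H(z)-1\bigr|\le\epsilon$. (3) Let $0<a\le b$. As $k\to\infty$, uniformly over all $\alpha\in[a,b]$ such that $r=\alpha k^{\nu-1}$ is an integer, the number of nonnegative integer $\nu$-way $k\times\dots\times k$ tables with all sectional sums equal to $r$ is $$(1+o(1))\bigl((\alpha+1)^{\alpha+1}\alpha^{-\alpha}\bigr)^{k^\nu}(2\pi\alpha^2+2\pi\alpha)^{-(k\nu-\nu+1)/2}\,k^{(\nu-\nu^2)(k-1)/2}.$$ (4) Let $0<a\le b<1$. As $k\to\infty$, uniformly over all $\alpha\in[a,b]$ such that $r=\alpha k^{\nu-1}$ is an integer, the number of binary $\nu$-way $k\times\dots\times k$ tables with all sectional sums equal to $r$ is $$(1+o(1))\bigl(\alpha^{\alpha}(1-\alpha)^{1-\alpha}\bigr)^{-k^\nu}(2\pi\alpha-2\pi\alpha^2)^{-(k\nu-\nu+1)/2}\,k^{(\nu-\nu^2)(k-1)/2}.$$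 -/

import Mathlib

open Matrix

noncomputable section

/-! Polytopes `A x = b`, `x ≥ 0` (or `0 ≤ x ≤ 1`) with integer data, and the Gaussian formulas.
`D` indexes the equations and `J` the coordinates. -/

section General

variable {D J : Type} [Fintype D] [DecidableEq D] [Fintype J]

/-- The polytope of all real `x` with `A x = b` and `x ≥ 0`. -/
def polytope (A : Matrix D J ℤ) (b : D → ℤ) : Set (J → ℝ) :=
  {x | (A.map (Int.cast : ℤ → ℝ)) *ᵥ x = (fun i => (b i : ℝ)) ∧ ∀ j, 0 ≤ x j}

/-- The polytope of all real `x` with `A x = b` and `0 ≤ x ≤ 1`. -/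
def polytope01 (A : Matrix D J ℤ) (b : D → ℤ) : Set (J → ℝ) :=
  {x | x ∈ polytope A b ∧ ∀ j, x j ≤ 1}

/-- The number of integer points in a set. -/
def numIntegerPoints (P : Set (J → ℝ)) : ℕ :=
  {x | x ∈ P ∧ ∀ j, ∃ m : ℤ, x j = (m : ℝ)}.ncard

/-- The number of points in a set all of whose coordinates are `0` or `1`. -/
def numBinaryPoints (P : Set (J → ℝ)) : ℕ :=
  {x | x ∈ P ∧ ∀ j, x j = 0 ∨ x j = 1}.ncard

/-- The entropy `g` of a vector of independent geometric random variables with expectations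
`x j`. -/
def geomEntropy (x : J → ℝ) : ℝ :=
  ∑ j, ((x j + 1) * Real.log (x j + 1) - x j * Real.log (x j))

/-- The entropy `h` of a vector of independent Bernoulli random variables with expectations
`x j`. -/
def bernoulliEntropy (x : J → ℝ) : ℝ :=
  ∑ j, (x j * Real.log (1 / x j) + (1 - x j) * Real.log (1 / (1 - x j)))

/-- The matrix whose `j`-th column is `√(w j)` times the `j`-th column of `A`. -/
def weightedMatrix (A : Matrix D J ℤ) (w : J → ℝ) : Matrix D J ℝ :=
  Matrix.of fun i j => Real.sqrt (w j) * (A i j : ℝ)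

/-- The image `Λ = A(ℤ^J)` of the integer lattice, as a lattice in `ℝ^D`. -/
def imageLattice (A : Matrix D J ℤ) : Submodule ℤ (D → ℝ) :=
  Submodule.span ℤ (Set.range fun (y : J → ℤ) (i : D) => ((A *ᵥ y) i : ℝ))

/-- `e^S det Λ / ((2π)^{d/2} (det B Bᵀ)^{1/2})`, where `B` has columns `√(w j) a_j`. -/
def gaussianFormula (A : Matrix D J ℤ) (S : ℝ) (w : J → ℝ) : ℝ :=
  Real.exp S * ZLattice.covolume (imageLattice A) /
    ((2 * Real.pi) ^ ((Fintype.card D : ℝ) / 2) *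
      Real.sqrt (weightedMatrix A w * (weightedMatrix A w)ᵀ).det)

/-- The Gaussian formula for the number of integer points. -/
def gaussianInteger (A : Matrix D J ℤ) (z : J → ℝ) : ℝ :=
  gaussianFormula A (geomEntropy z) (fun j => z j ^ 2 + z j)

/-- The Gaussian formula for the number of 0-1 points. -/
def gaussianBinary (A : Matrix D J ℤ) (z : J → ℝ) : ℝ :=
  gaussianFormula A (bernoulliEntropy z) (fun j => z j - z j ^ 2)

end General

/-! Multi-way tables of format `k 0 × … × k (ν - 1)`. -/

/-- Index set of the entries of the table. -/
abbrev Cell {ν : ℕ} (k : Fin ν → ℕ) : Type := (i : Fin ν) → Fin (k i)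

/-- Index set of the equations: `some ⟨i, j⟩` is the `j`-th sectional sum in direction `i`, with
the last section of each direction left out, and `none` is the total sum. -/
abbrev Constraint {ν : ℕ} (k : Fin ν → ℕ) : Type := Option ((i : Fin ν) × Fin (k i - 1))

/-- The matrix of the equations that prescribe all but the last sectional sums in each direction,
and the total sum. -/
def tableMatrix {ν : ℕ} (k : Fin ν → ℕ) : Matrix (Constraint k) (Cell k) ℤ :=
  Matrix.of fun c p =>
    match c with
    | none => 1
    | some ⟨i, j⟩ => if (p i : ℕ) = (j : ℕ) then 1 else 0

/-- The right-hand side of the equations: sectional sums `β i j` and total sum `N`. -/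
def tableRhs {ν : ℕ} (k : Fin ν → ℕ) (β : (i : Fin ν) → Fin (k i) → ℕ) (N : ℕ) :
    Constraint k → ℤ
  | none => N
  | some ⟨i, j⟩ => β i (Fin.castLE (Nat.sub_le _ _) j)

/-- The transportation polytope with sectional sums `β` and total sum `N`. -/
def transportPolytope {ν : ℕ} (k : Fin ν → ℕ) (β : (i : Fin ν) → Fin (k i) → ℕ) (N : ℕ) :
    Set (Cell k → ℝ) :=
  polytope (tableMatrix k) (tableRhs k β N)

/-- The transportation polytope truncated by the inequalities `x ≤ 1`. -/
def transportPolytope01 {ν : ℕ} (k : Fin ν → ℕ) (β : (i : Fin ν) → Fin (k i) → ℕ) (N : ℕ) :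
    Set (Cell k → ℝ) :=
  polytope01 (tableMatrix k) (tableRhs k β N)

end

/-!
Give the cells independent geometric (for binary tables, Bernoulli) entries with means `z`. Since
`z` is a critical point of the entropy on the polytope, every solution of `A x = b` then has the
same probability, `exp (-g z)` (resp. `exp (-h z)`). So the number of tables is
`exp (g z) * ℙ (A X = b)`, and what is needed is a local limit theorem for `A X`.

By Fourier inversion, `ℙ (A X = b)` is the integral over the torus of a product of characteristic
functions of the entries at the linear forms `⟨a_p, t⟩`. Each coordinate `t_c` is a signed sum of
boundedly many forms, in about `n ^ (ν - 1)` essentially disjoint ways, so that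
`f (t_c) ^ 2 ≤ const * n ^ (1 - ν) * ∑ p, f ⟨a_p, t⟩ ^ 2` for every even subadditive `f ≥ 0`.
With `f = |·|`, on the ellipsoid `∑ p, ⟨a_p, t⟩ ^ 2 ≤ s` all forms are at most of order
`(s / n ^ (ν - 1)) ^ (1 / 2)`, and the integrand is Gaussian up to a relative error of order
`s ^ (3 / 2) / n ^ ((ν - 1) / 2)`. With `f` the chord length `2 * |sin (· / 2)|`, on which the decay
of the characteristic functions depends, the integrand is at most `exp (-const * s)` off the
ellipsoid. The latter bound has to beat the Gaussian normalization, whose logarithm is of order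
`n * log n`. For `ν ≥ 5` the choice `s = n ^ (5 / 4)` makes both errors vanish.
-/

open MeasureTheory

/-! ### Gaussian integrals -/

section Gaussian

variable {D : Type*} [Fintype D] {a : ℝ}

lemma exp_neg_mul_dotProduct_self (a : ℝ) (y : D → ℝ) :
    Real.exp (-a * (y ⬝ᵥ y)) = ∏ i, Real.exp (-a * y i ^ 2) := by
  simp only [← Real.exp_sum, dotProduct, Finset.mul_sum, sq]

lemma integrable_exp_neg_mul_dotProduct_self (ha : 0 < a) :
    Integrable fun y : D → ℝ => Real.exp (-a * (y ⬝ᵥ y)) := by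
  simp_rw [exp_neg_mul_dotProduct_self]
  exact Integrable.fintype_prod (f := fun _ x => Real.exp (-a * x ^ 2))
    fun _ => integrable_exp_neg_mul_sq ha

lemma integral_exp_neg_mul_dotProduct_self (a : ℝ) :
    ∫ y : D → ℝ, Real.exp (-a * (y ⬝ᵥ y)) = √(Real.pi / a) ^ Fintype.card D := by
  simp_rw [exp_neg_mul_dotProduct_self]
  rw [integral_fintype_prod_volume_eq_pow (fun x : ℝ => Real.exp (-a * x ^ 2)), integral_gaussian]

variable {Q : Matrix D D ℝ}

lemma exists_eq_transpose_mul_self_of_posDef [DecidableEq D] (hQ : Q.PosDef) :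
    ∃ Y : Matrix D D ℝ, Y.det ≠ 0 ∧ Q = Yᵀ * Y := by
  open scoped MatrixOrder Matrix.Norms.L2Operator in
  obtain ⟨Y, hY⟩ := CStarAlgebra.nonneg_iff_eq_star_mul_self.mp hQ.posSemidef.nonneg
  rw [star_eq_conjTranspose, conjTranspose_eq_transpose_of_trivial] at hY
  refine ⟨Y, fun h => hQ.det_pos.ne' ?_, hY⟩
  rw [hY, det_mul, h, mul_zero]

lemma dotProduct_transpose_mul_self_mulVec [DecidableEq D] (Y : Matrix D D ℝ) (t : D → ℝ) :
    t ⬝ᵥ (Yᵀ * Y) *ᵥ t = toLin' Y t ⬝ᵥ toLin' Y t := by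
  rw [toLin'_apply, ← mulVec_mulVec, dotProduct_mulVec, vecMul_transpose]

lemma integrable_exp_neg_mul_quadratic (hQ : Q.PosDef) (ha : 0 < a) :
    Integrable fun t : D → ℝ => Real.exp (-a * (t ⬝ᵥ Q *ᵥ t)) := by
  classical
  obtain ⟨Y, hY0, rfl⟩ := exists_eq_transpose_mul_self_of_posDef hQ
  simp_rw [dotProduct_transpose_mul_self_mulVec]
  have hmap : Integrable (fun y : D → ℝ => Real.exp (-a * (y ⬝ᵥ y)))
      (Measure.map (toLin' Y) volume) := by
    rw [Real.map_matrix_volume_pi_eq_smul_volume_pi hY0]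
    exact (integrable_exp_neg_mul_dotProduct_self ha).smul_measure ENNReal.ofReal_ne_top
  exact hmap.comp_measurable (LinearMap.continuous_on_pi _).measurable

lemma integral_exp_neg_mul_quadratic [DecidableEq D] (hQ : Q.PosDef) (a : ℝ) :
    ∫ t : D → ℝ, Real.exp (-a * (t ⬝ᵥ Q *ᵥ t)) =
      √(Real.pi / a) ^ Fintype.card D / √Q.det := by
  obtain ⟨Y, hY0, rfl⟩ := exists_eq_transpose_mul_self_of_posDef hQ
  simp_rw [dotProduct_transpose_mul_self_mulVec]
  rw [← integral_map (f := fun y : D → ℝ => Real.exp (-a * (y ⬝ᵥ y)))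
      (LinearMap.continuous_on_pi (toLin' Y)).measurable.aemeasurable
      (by unfold dotProduct; fun_prop),
    Real.map_matrix_volume_pi_eq_smul_volume_pi hY0, integral_smul_measure,
    integral_exp_neg_mul_dotProduct_self, det_mul, det_transpose, ← sq, Real.sqrt_sq_eq_abs,
    ENNReal.toReal_ofReal (abs_nonneg _), abs_inv, smul_eq_mul]
  exact (div_eq_inv_mul _ _).symm

end Gaussian

/-! ### Fourier inversion on the torus -/

section Fourier

lemma integral_exp_int_mul (m : ℤ) :
    ∫ x in Set.Ioc (-Real.pi) Real.pi, Complex.exp (Complex.I * (x * m)) =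
      if m = 0 then (2 * Real.pi : ℂ) else 0 := by
  rw [← intervalIntegral.integral_of_le (by linarith [Real.pi_pos])]
  split_ifs with h
  · simp only [h, Int.cast_zero, mul_zero, Complex.exp_zero, intervalIntegral.integral_const,
      Complex.real_smul]
    push_cast
    ring
  · have hc : (Complex.I * m : ℂ) ≠ 0 := mul_ne_zero Complex.I_ne_zero (Int.cast_ne_zero.mpr h)
    have hperiod : Complex.exp (Complex.I * m * Real.pi) =
        Complex.exp (Complex.I * m * (-Real.pi : ℝ)) :=
      Complex.exp_eq_exp_iff_exists_int.mpr ⟨m, by push_cast; ring⟩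
    calc ∫ x in (-Real.pi)..Real.pi, Complex.exp (Complex.I * (x * m))
        = ∫ x in (-Real.pi)..Real.pi, Complex.exp (Complex.I * m * x) := by
          simp only [mul_assoc, mul_comm (m : ℂ)]
      _ = 0 := by rw [integral_exp_mul_complex hc, hperiod, sub_self, zero_div]

/-- The cube `(-π, π]^D`, a fundamental domain for the torus `(ℝ / 2πℤ)^D`. -/
def torusCube (D : Type*) : Set (D → ℝ) := Set.univ.pi fun _ => Set.Ioc (-Real.pi) Real.pi

variable {D J : Type*} [Fintype D]

lemma volume_torusCube : volume (torusCube D) = ENNReal.ofReal (2 * Real.pi) ^ Fintype.card D := by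
  rw [torusCube, volume_pi_pi]
  simp only [Real.volume_Ioc, Finset.prod_const, Finset.card_univ, sub_neg_eq_add, ← two_mul]

lemma volumeReal_torusCube :
    volume.real (torusCube D) = (2 * Real.pi) ^ Fintype.card D := by
  rw [Measure.real, volume_torusCube, ENNReal.toReal_pow,
    ENNReal.toReal_ofReal (by positivity)]

instance isFiniteMeasure_restrict_torusCube :
    IsFiniteMeasure ((volume : Measure (D → ℝ)).restrict (torusCube D)) :=
  isFiniteMeasure_restrict.mpr <| by
    rw [volume_torusCube]
    exact (ENNReal.pow_lt_top ENNReal.ofReal_lt_top).ne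

lemma setIntegral_torusCube_exp (m : D → ℤ) :
    ∫ t in torusCube D, Complex.exp (Complex.I * (∑ c, t c * m c : ℝ)) =
      if m = 0 then (2 * Real.pi : ℂ) ^ Fintype.card D else 0 := by
  have hprod (t : D → ℝ) : Complex.exp (Complex.I * (∑ c, t c * m c : ℝ)) =
      ∏ c, Complex.exp (Complex.I * (t c * m c)) := by
    rw [← Complex.exp_sum, ← Finset.mul_sum]
    push_cast
    rfl
  simp_rw [hprod]
  rw [torusCube, volume_pi, Measure.restrict_pi_pi, integral_fintype_prod_eq_prod (𝕜 := ℂ)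
      fun c (x : ℝ) => Complex.exp (Complex.I * (x * m c))]
  simp_rw [integral_exp_int_mul]
  split_ifs with hm
  · simp only [hm, Pi.zero_apply, if_true, Finset.prod_const, Finset.card_univ]
  · obtain ⟨c, hc⟩ := Function.ne_iff.mp hm
    exact Finset.prod_eq_zero (Finset.mem_univ c) (if_neg hc)

/-- The linear form `t ↦ ⟨a_j, t⟩` given by the `j`-th column `a_j` of `A`. -/
def linForm (A : Matrix D J ℤ) (t : D → ℝ) (j : J) : ℝ := ∑ c, (A c j : ℝ) * t c

@[fun_prop]
lemma continuous_linForm (A : Matrix D J ℤ) (j : J) : Continuous fun t => linForm A t j := by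
  unfold linForm
  fun_prop

lemma sum_linForm_mul [Fintype J] (A : Matrix D J ℤ) (t : D → ℝ) (x : J → ℝ) :
    ∑ j, linForm A t j * x j = ∑ c, t c * (A.map (Int.cast : ℤ → ℝ) *ᵥ x) c := by
  simp only [linForm, mulVec, dotProduct, map_apply, Finset.sum_mul, Finset.mul_sum]
  rw [Finset.sum_comm]
  exact Finset.sum_congr rfl fun c _ => Finset.sum_congr rfl fun j _ => by ring

/-- The characteristic function of a measure on `ℕ`. -/
noncomputable def natCharFun (μ : Measure ℕ) (θ : ℝ) : ℂ :=
  ∫ x : ℕ, Complex.exp (Complex.I * (θ * x)) ∂μ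

lemma continuous_natCharFun (μ : Measure ℕ) [IsFiniteMeasure μ] : Continuous (natCharFun μ) := by
  refine continuous_of_dominated (bound := fun _ => 1) (fun _ => .of_discrete)
    (fun θ => .of_forall fun x => ?_) (integrable_const _) (.of_forall fun x => by fun_prop)
  rw [mul_comm, ← Complex.ofReal_natCast, ← Complex.ofReal_mul, Complex.norm_exp_ofReal_mul_I]

variable [Fintype J] (A : Matrix D J ℤ) (μ : J → Measure ℕ) [∀ j, IsProbabilityMeasure (μ j)]

lemma prod_natCharFun_linForm_mul_exp (b : D → ℤ) (t : D → ℝ) :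
    (∏ j, natCharFun (μ j) (linForm A t j)) * Complex.exp (-(Complex.I * (∑ c, t c * b c : ℝ))) =
      ∫ x : J → ℕ, Complex.exp
        (Complex.I * (∑ c, t c * ((A *ᵥ fun j => (x j : ℤ)) c - b c : ℤ) : ℝ)) ∂Measure.pi μ := by
  simp only [natCharFun]
  rw [← integral_fintype_prod_eq_prod (𝕜 := ℂ)
    (fun j (x : ℕ) => Complex.exp (Complex.I * ((linForm A t j : ℝ) * x))), ← integral_mul_const]
  refine integral_congr_ae (.of_forall fun x => ?_)
  have hsum : ∑ j, linForm A t j * x j = ∑ c, t c * ((A *ᵥ fun j => (x j : ℤ)) c : ℤ) := by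
    rw [sum_linForm_mul]
    simp [mulVec, dotProduct]
  have hsub : ∑ c, t c * ((A *ᵥ fun j => (x j : ℤ)) c - b c : ℤ) =
      ∑ j, linForm A t j * x j - ∑ c, t c * b c := by
    simp only [hsum, Int.cast_sub, mul_sub, Finset.sum_sub_distrib]
  simp only [← Complex.exp_sum, ← Complex.exp_add, ← Finset.mul_sum, hsub]
  push_cast
  ring_nf

lemma measureReal_linear_system (b : D → ℤ) :
    (((Measure.pi μ).real {x : J → ℕ | (A *ᵥ fun j => (x j : ℤ)) = b} : ℝ) : ℂ) *
        (2 * Real.pi : ℂ) ^ Fintype.card D =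
      ∫ t in torusCube D, (∏ j, natCharFun (μ j) (linForm A t j)) *
        Complex.exp (-(Complex.I * (∑ c, t c * b c : ℝ))) := by
  classical
  have hinner (x : J → ℕ) : (∫ t in torusCube D, Complex.exp
      (Complex.I * (∑ c, t c * ((A *ᵥ fun j => (x j : ℤ)) c - b c : ℤ) : ℝ))) =
      {x : J → ℕ | (A *ᵥ fun j => (x j : ℤ)) = b}.indicator
        (fun _ => (2 * Real.pi : ℂ) ^ Fintype.card D) x := by
    rw [setIntegral_torusCube_exp fun c => (A *ᵥ fun j => (x j : ℤ)) c - b c, Set.indicator]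
    simp only [Set.mem_ofPred_eq, funext_iff, Pi.zero_apply, sub_eq_zero]
  simp_rw [prod_natCharFun_linForm_mul_exp]
  rw [integral_integral_swap]
  · simp_rw [hinner]
    rw [integral_indicator_const _ (Set.to_countable _).measurableSet, Complex.real_smul]
  · refine Integrable.of_bound (C := 1) (Measurable.aestronglyMeasurable
      (measurable_from_prod_countable_left fun x => ?_)) (.of_forall fun tx => ?_)
    · simp only [Function.uncurry]
      fun_prop
    · simp only [Function.uncurry]
      rw [mul_comm, Complex.norm_exp_ofReal_mul_I]

end Fourier

/-! ### Characteristic functions of geometric and Bernoulli random variables -/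

section CharFun

variable {x : ℝ}

/-- The reciprocal of the characteristic function of the geometric distribution with expectation
`x`. For `x = -p` it is the characteristic function of the Bernoulli distribution with
expectation `p`, so that both distributions are covered by estimates on this function. -/
noncomputable def invCharFun (x θ : ℝ) : ℂ := 1 + x - x * Complex.exp (Complex.I * θ)

/-- The logarithm of the characteristic function of the Gaussian variable with expectation `x` and
variance `x + x ^ 2`. -/
noncomputable def gaussianExponent (x θ : ℝ) : ℂ :=
  Complex.I * (x * θ) - (x + x ^ 2) * θ ^ 2 / 2

/-- A constant for the cubic error in the approximation of `invCharFun x` by a Gaussian. -/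
noncomputable def cubicConst (x : ℝ) : ℝ :=
  x * (1 + x) * (1 + 2 * x) * Real.exp ((x + x ^ 2) / 2)

lemma cubicConst_nonneg (hx : 0 ≤ x) : 0 ≤ cubicConst x := by
  unfold cubicConst
  positivity

lemma cubicConst_le_cubicConst {y : ℝ} (hx : 0 ≤ x) (hxy : x ≤ y) :
    cubicConst x ≤ cubicConst y := by
  have hy : 0 ≤ y := hx.trans hxy
  unfold cubicConst
  gcongr

lemma normSq_invCharFun (x θ : ℝ) :
    ‖invCharFun x θ‖ ^ 2 = 1 + 2 * (x + x ^ 2) * (1 - Real.cos θ) := by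
  have hreim : invCharFun x θ = ⟨1 + x - x * Real.cos θ, -(x * Real.sin θ)⟩ := by
    rw [invCharFun, mul_comm Complex.I, Complex.exp_mul_I]
    apply Complex.ext <;> simp [Complex.cos_ofReal_re, Complex.sin_ofReal_re]
  rw [hreim, ← Complex.normSq_eq_norm_sq, Complex.normSq_mk]
  linear_combination x ^ 2 * Real.sin_sq_add_cos_sq θ

lemma norm_exp_gaussianExponent (x θ : ℝ) :
    ‖Complex.exp (gaussianExponent x θ)‖ = Real.exp (-((x + x ^ 2) * θ ^ 2 / 2)) := by
  have hsplit : gaussianExponent x θ =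
      ((x * θ : ℝ) : ℂ) * Complex.I + ((-((x + x ^ 2) * θ ^ 2 / 2) : ℝ) : ℂ) := by
    rw [gaussianExponent]
    push_cast
    ring
  rw [hsplit, Complex.exp_add, norm_mul, Complex.norm_exp_ofReal_mul_I, one_mul,
    Complex.norm_exp_ofReal]

-- The terms of order `0` and `1` in `θ` cancel because `x + x ^ 2` is the variance.
lemma hasDerivAt_invCharFun_mul_exp (x θ : ℝ) :
    HasDerivAt (fun θ => invCharFun x θ * Complex.exp (gaussianExponent x θ))
      ((Complex.I * x * (x + x ^ 2) * θ ^ 2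
          - x * (Complex.exp (Complex.I * θ) - 1 - Complex.I * θ)
            * (Complex.I + Complex.I * x - (x + x ^ 2) * θ))
        * Complex.exp (gaussianExponent x θ)) θ := by
  have hθ : HasDerivAt (fun θ : ℝ => (θ : ℂ)) 1 θ := Complex.ofRealCLM.hasDerivAt
  have hN : HasDerivAt (invCharFun x) (-(x * (Complex.exp (Complex.I * θ) * (Complex.I * 1)))) θ :=
    ((hθ.const_mul Complex.I).cexp.const_mul (x : ℂ)).const_sub _
  have hu : HasDerivAt (gaussianExponent x)
      (Complex.I * (x * 1) - (x + x ^ 2) * ((2 : ℕ) * (θ : ℂ) ^ (2 - 1) * 1) / 2) θ :=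
    ((hθ.const_mul (x : ℂ)).const_mul Complex.I).sub (((hθ.pow 2).const_mul _).div_const 2)
  refine (hN.mul hu.cexp).congr_deriv ?_
  unfold invCharFun
  push_cast
  linear_combination (-x ^ 2 * θ - x * θ) * Complex.exp (gaussianExponent x θ) * Complex.I_sq

lemma norm_deriv_invCharFun_mul_exp_le (x : ℝ) {θ : ℝ} (hθ : |θ| ≤ 1) :
    ‖(Complex.I * x * (x + x ^ 2) * θ ^ 2
        - x * (Complex.exp (Complex.I * θ) - 1 - Complex.I * θ)
          * (Complex.I + Complex.I * x - (x + x ^ 2) * θ))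
      * Complex.exp (gaussianExponent x θ)‖ ≤ cubicConst |x| * θ ^ 2 := by
  have hθ2 : θ ^ 2 ≤ 1 := (sq_le_one_iff_abs_le_one θ).mpr hθ
  have hvar : ‖(x + x ^ 2 : ℂ)‖ ≤ |x| + |x| ^ 2 :=
    (norm_add_le _ _).trans_eq (by simp)
  have hrem : ‖Complex.exp (Complex.I * θ) - 1 - Complex.I * θ‖ ≤ θ ^ 2 := by
    simpa using Complex.norm_exp_sub_one_sub_id_le (x := Complex.I * θ) (by simpa using hθ)
  have hfactor : ‖Complex.I + Complex.I * x - (x + x ^ 2) * θ‖ ≤ 1 + |x| + (|x| + |x| ^ 2) := by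
    calc _ ≤ ‖Complex.I‖ + ‖Complex.I * x‖ + ‖(x + x ^ 2 : ℂ)‖ * ‖(θ : ℂ)‖ :=
          (norm_sub_le _ _).trans (add_le_add (norm_add_le _ _) (norm_mul_le _ _))
      _ ≤ 1 + |x| + (|x| + |x| ^ 2) * 1 := by
          simp only [norm_mul, Complex.norm_I, Complex.norm_real, Real.norm_eq_abs, one_mul]
          gcongr
      _ = _ := by ring
  have hexp : ‖Complex.exp (gaussianExponent x θ)‖ ≤ Real.exp ((|x| + |x| ^ 2) / 2) := by
    rw [norm_exp_gaussianExponent, Real.exp_le_exp, sq_abs]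
    nlinarith [neg_abs_le x, abs_nonneg x, sq_nonneg x, sq_nonneg θ]
  rw [norm_mul]
  calc _ ≤ (|x| * (|x| + |x| ^ 2) * θ ^ 2 + |x| * θ ^ 2 * (1 + |x| + (|x| + |x| ^ 2)))
          * Real.exp ((|x| + |x| ^ 2) / 2) := by
        refine mul_le_mul ((norm_sub_le _ _).trans ?_) hexp (norm_nonneg _) (by positivity)
        simp only [norm_mul, norm_pow, Complex.norm_I, Complex.norm_real, Real.norm_eq_abs,
          one_mul, sq_abs θ]
        gcongr
    _ = cubicConst |x| * θ ^ 2 := by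
        rw [cubicConst]
        ring

lemma norm_invCharFun_mul_exp_sub_one_le (x : ℝ) {θ : ℝ} (hθ : |θ| ≤ 1) :
    ‖invCharFun x θ * Complex.exp (gaussianExponent x θ) - 1‖ ≤ cubicConst |x| * |θ| ^ 3 := by
  have hmean := (convex_closedBall (0 : ℝ) |θ|).norm_image_sub_le_of_norm_hasDerivWithin_le
    (C := cubicConst |x| * θ ^ 2) (x := 0) (y := θ)
    (fun t _ => (hasDerivAt_invCharFun_mul_exp x t).hasDerivWithinAt)
    (fun t ht => ?_) (by simp) (by simp)
  · have hzero : invCharFun x 0 * Complex.exp (gaussianExponent x 0) = 1 := by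
      simp [invCharFun, gaussianExponent]
    rwa [hzero, sub_zero, Real.norm_eq_abs, ← sq_abs, mul_assoc, ← pow_succ] at hmean
  · have htθ : |t| ≤ |θ| := by simpa using ht
    exact (norm_deriv_invCharFun_mul_exp_le x (htθ.trans hθ)).trans
      (mul_le_mul_of_nonneg_left (sq_le_sq.mpr htθ) (cubicConst_nonneg (abs_nonneg x)))

open ProbabilityTheory

/-- The geometric distribution with expectation `x ≥ 0`; the projection to the unit interval only
serves to provide a bundled success probability `1 / (1 + x)`. -/
noncomputable def geomDist (x : ℝ) : Measure ℕ :=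
  geometricMeasure (Set.projIcc 0 1 zero_le_one (1 / (1 + x)))

instance (x : ℝ) : IsProbabilityMeasure (geomDist x) := by unfold geomDist; infer_instance

/-- The Bernoulli distribution with expectation `x ∈ [0, 1]`. -/
noncomputable def bernDist (x : ℝ) : Measure ℕ :=
  bernoulliMeasure 1 0 (Set.projIcc 0 1 zero_le_one x)

instance (x : ℝ) : IsProbabilityMeasure (bernDist x) := by unfold bernDist; infer_instance

lemma coe_projIcc_of_mem {y : ℝ} (h0 : 0 ≤ y) (h1 : y ≤ 1) :
    ((Set.projIcc (0 : ℝ) 1 zero_le_one y : unitInterval) : ℝ) = y := by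
  rw [Set.projIcc_of_mem zero_le_one (Set.mem_Icc.mpr ⟨h0, h1⟩)]

lemma coe_projIcc_inv (hx : 0 < x) :
    ((Set.projIcc (0 : ℝ) 1 zero_le_one (1 / (1 + x)) : unitInterval) : ℝ) = 1 / (1 + x) :=
  coe_projIcc_of_mem (by positivity) (by rw [div_le_one (by positivity)]; linarith)

lemma projIcc_inv_ne_zero (hx : 0 < x) :
    (Set.projIcc (0 : ℝ) 1 zero_le_one (1 / (1 + x)) : unitInterval) ≠ 0 := by
  rw [← unitInterval.coe_ne_zero, coe_projIcc_inv hx]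
  positivity

lemma geomDist_real_singleton (hx : 0 < x) (n : ℕ) :
    (geomDist x).real {n} =
      Real.exp (-((x + 1) * Real.log (x + 1) - x * Real.log x)
        - (n - x) * Real.log ((1 + x) / x)) := by
  have hfail : (1 : ℝ) - 1 / (1 + x) = x / (1 + x) := by field_simp; ring
  have hexponent : -((x + 1) * Real.log (x + 1) - x * Real.log x)
      - (n - x) * Real.log ((1 + x) / x) = n * Real.log (x / (1 + x)) + -Real.log (1 + x) := by
    rw [Real.log_div (by positivity) hx.ne', Real.log_div hx.ne' (by positivity), add_comm x 1]
    ring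
  rw [geomDist, geometricMeasure_real_singleton (projIcc_inv_ne_zero hx), coe_projIcc_inv hx, hfail,
    hexponent, Real.exp_add, Real.exp_nat_mul, Real.exp_log (by positivity), Real.exp_neg,
    Real.exp_log (by positivity), one_div]

lemma natCharFun_geomDist (hx : 0 < x) (θ : ℝ) :
    natCharFun (geomDist x) θ = (invCharFun x θ)⁻¹ := by
  have hx1 : (1 + x : ℂ) ≠ 0 := by exact_mod_cast (by positivity : (1 + x : ℝ) ≠ 0)
  have hterm (n : ℕ) : ((1 - 1 / (1 + x) : ℝ) ^ n * (1 / (1 + x))) •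
      Complex.exp (Complex.I * (θ * n)) =
      ((x / (1 + x) : ℝ) * Complex.exp (Complex.I * θ)) ^ n * (1 + x : ℂ)⁻¹ := by
    rw [show (1 : ℝ) - 1 / (1 + x) = x / (1 + x) by field_simp; ring, Complex.real_smul, mul_pow,
      ← Complex.exp_nat_mul, show (n : ℂ) * (Complex.I * θ) = Complex.I * (θ * n) by ring]
    push_cast
    ring
  have hratio : ‖((x / (1 + x) : ℝ) : ℂ) * Complex.exp (Complex.I * θ)‖ < 1 := by
    rw [norm_mul, mul_comm Complex.I, Complex.norm_exp_ofReal_mul_I, Complex.norm_real,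
      Real.norm_of_nonneg (by positivity), mul_one, div_lt_one (by positivity)]
    linarith
  rw [natCharFun, geomDist, integral_geometricMeasure (projIcc_inv_ne_zero hx), coe_projIcc_inv hx]
  simp_rw [hterm]
  rw [tsum_mul_right, tsum_geometric_of_norm_lt_one hratio, ← mul_inv, invCharFun]
  push_cast
  field_simp

lemma bernDist_real_one (h0 : 0 ≤ x) (h1 : x ≤ 1) : (bernDist x).real {1} = x := by
  rw [bernDist, bernoulliMeasure_real_apply_of_mem_of_notMem _ (by simp) (by simp) (by simp),
    coe_projIcc_of_mem h0 h1]

lemma bernDist_real_zero (h0 : 0 ≤ x) (h1 : x ≤ 1) : (bernDist x).real {0} = 1 - x := by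
  rw [bernDist, bernoulliMeasure_real_apply_of_notMem_of_mem _ (by simp) (by simp) (by simp),
    coe_projIcc_of_mem h0 h1]

lemma bernDist_real_singleton (h0 : 0 < x) (h1 : x < 1) {n : ℕ} (hn : n = 0 ∨ n = 1) :
    (bernDist x).real {n} =
      Real.exp (-(x * Real.log (1 / x) + (1 - x) * Real.log (1 / (1 - x)))
        - (n - x) * Real.log ((1 - x) / x)) := by
  have hcompl : 0 < 1 - x := sub_pos.mpr h1
  rw [Real.log_div hcompl.ne' h0.ne', one_div, one_div, Real.log_inv, Real.log_inv]
  rcases hn with rfl | rfl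
  · rw [bernDist_real_zero h0.le h1.le, Nat.cast_zero]
    ring_nf
    rw [Real.exp_log hcompl]
  · rw [bernDist_real_one h0.le h1.le, Nat.cast_one]
    ring_nf
    rw [Real.exp_log h0]

lemma ae_bernDist (x : ℝ) : ∀ᵐ n ∂bernDist x, n = 0 ∨ n = 1 := by
  rw [ae_iff, bernDist, ← measureReal_eq_zero_iff]
  apply bernoulliMeasure_real_apply_of_notMem_of_notMem <;> simp

lemma natCharFun_bernDist (h0 : 0 ≤ x) (h1 : x ≤ 1) (θ : ℝ) :
    natCharFun (bernDist x) θ = invCharFun (-x) θ := by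
  rw [natCharFun, bernDist, integral_bernoulliMeasure, coe_projIcc_of_mem h0 h1, invCharFun]
  simp only [Nat.cast_one, Nat.cast_zero, mul_one, mul_zero, Complex.exp_zero, Complex.real_smul]
  push_cast
  ring

/-- A distribution with characteristic function of decay rate `κ` that agrees, up to a cubic
relative error with constant `L`, with that of the Gaussian variable with expectation `z` and
variance `w`. -/
structure IsNearGaussian (μ : Measure ℕ) (z w κ L : ℝ) : Prop where
  norm_natCharFun_le (θ : ℝ) : ‖natCharFun μ θ‖ ≤ Real.exp (-(κ * (1 - Real.cos θ)))
  norm_natCharFun_mul_exp_sub_one_le {θ : ℝ} (hθ : |θ| ≤ 1) :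
    ‖natCharFun μ θ * Complex.exp (-(Complex.I * (z * θ)) + w * θ ^ 2 / 2) - 1‖ ≤ L * |θ| ^ 3

lemma IsNearGaussian.mono {μ : Measure ℕ} {z w κ κ' L L' : ℝ} (h : IsNearGaussian μ z w κ L)
    (hκ : κ' ≤ κ) (hL : L ≤ L') : IsNearGaussian μ z w κ' L' where
  norm_natCharFun_le θ := (h.norm_natCharFun_le θ).trans <| by
    gcongr
    linarith [Real.cos_le_one θ]
  norm_natCharFun_mul_exp_sub_one_le hθ :=
    (h.norm_natCharFun_mul_exp_sub_one_le hθ).trans (by gcongr)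

lemma one_le_norm_invCharFun (hx : 0 ≤ x) (θ : ℝ) : 1 ≤ ‖invCharFun x θ‖ := by
  rw [← one_le_sq_iff₀ (norm_nonneg _), normSq_invCharFun, le_add_iff_nonneg_right]
  exact mul_nonneg (by positivity) (by linarith [Real.cos_le_one θ])

lemma norm_natCharFun_geomDist_le (hx : 0 < x) (θ : ℝ) :
    ‖natCharFun (geomDist x) θ‖ ≤
      Real.exp (-((x ^ 2 + x) / (1 + 4 * (x ^ 2 + x)) * (1 - Real.cos θ))) := by
  have hs0 : 0 ≤ 1 - Real.cos θ := by linarith [Real.cos_le_one θ]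
  have hs2 : 1 - Real.cos θ ≤ 2 := by linarith [Real.neg_one_le_cos θ]
  have hnormSq := normSq_invCharFun x θ
  rw [add_comm x] at hnormSq
  have hw : 0 < x ^ 2 + x := by positivity
  generalize x ^ 2 + x = w, 1 - Real.cos θ = s at *
  have hpos : 0 < 1 + 2 * w * s := by positivity
  have hlog : 2 * (w / (1 + 4 * w) * s) ≤ Real.log (1 + 2 * w * s) :=
    calc 2 * (w / (1 + 4 * w) * s) = 2 * w * s / (1 + 4 * w) := by ring
      _ ≤ 2 * w * s / (1 + 2 * w * s) := by
        have : 2 * w * s ≤ 4 * w := by nlinarith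
        gcongr
      _ = 1 - (1 + 2 * w * s)⁻¹ := by field_simp; ring
      _ ≤ _ := Real.one_sub_inv_le_log_of_pos hpos
  rw [natCharFun_geomDist hx, norm_inv, Real.exp_neg]
  refine inv_anti₀ (Real.exp_pos _) ((pow_le_pow_iff_left₀ (by positivity) (norm_nonneg _)
    two_ne_zero).mp ?_)
  rw [hnormSq, ← Real.exp_nat_mul, ← Real.le_log_iff_exp_le hpos]
  exact_mod_cast hlog

lemma isNearGaussian_geomDist (hx : 0 < x) :
    IsNearGaussian (geomDist x) x (x ^ 2 + x) ((x ^ 2 + x) / (1 + 4 * (x ^ 2 + x)))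
      (Real.exp ((x ^ 2 + x) / 2) * cubicConst x) where
  norm_natCharFun_le := norm_natCharFun_geomDist_le hx
  norm_natCharFun_mul_exp_sub_one_le {θ} hθ := by
    have hN : invCharFun x θ ≠ 0 :=
      norm_pos_iff.mp (one_pos.trans_le (one_le_norm_invCharFun hx.le θ))
    have hexponent : -(Complex.I * (x * θ)) + ((x ^ 2 + x : ℝ) : ℂ) * θ ^ 2 / 2 =
        -gaussianExponent x θ := by
      rw [gaussianExponent]
      push_cast
      ring
    have hinv : (invCharFun x θ)⁻¹ * Complex.exp (-gaussianExponent x θ) - 1 =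
        -((invCharFun x θ)⁻¹ * Complex.exp (-gaussianExponent x θ)
          * (invCharFun x θ * Complex.exp (gaussianExponent x θ) - 1)) := by
      rw [Complex.exp_neg]
      field_simp [Complex.exp_ne_zero]
      ring
    have hexp : ‖Complex.exp (-gaussianExponent x θ)‖ ≤ Real.exp ((x ^ 2 + x) / 2) := by
      rw [Complex.exp_neg, norm_inv, norm_exp_gaussianExponent, ← Real.exp_neg, neg_neg,
        Real.exp_le_exp]
      nlinarith [(sq_le_one_iff_abs_le_one θ).mpr hθ]
    have hcubic := norm_invCharFun_mul_exp_sub_one_le x hθ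
    rw [abs_of_pos hx] at hcubic
    rw [natCharFun_geomDist hx, hexponent, hinv, norm_neg, norm_mul, norm_mul, norm_inv]
    calc _ ≤ 1 * Real.exp ((x ^ 2 + x) / 2) * (cubicConst x * |θ| ^ 3) := by
          gcongr
          exact inv_le_one_of_one_le₀ (one_le_norm_invCharFun hx.le θ)
      _ = _ := by ring

lemma isNearGaussian_bernDist (h0 : 0 ≤ x) (h1 : x ≤ 1) :
    IsNearGaussian (bernDist x) x (x - x ^ 2) (x - x ^ 2) (cubicConst x) where
  norm_natCharFun_le θ := by
    refine (pow_le_pow_iff_left₀ (norm_nonneg _) (by positivity) two_ne_zero).mp ?_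
    rw [natCharFun_bernDist h0 h1, normSq_invCharFun, ← Real.exp_nat_mul]
    refine le_of_eq_of_le ?_ (Real.add_one_le_exp _)
    push_cast
    ring
  norm_natCharFun_mul_exp_sub_one_le {θ} hθ := by
    have hexponent : -(Complex.I * (x * θ)) + ((x - x ^ 2 : ℝ) : ℂ) * θ ^ 2 / 2 =
        gaussianExponent (-x) θ := by
      rw [gaussianExponent]
      push_cast
      ring
    rw [natCharFun_bernDist h0 h1, hexponent]
    simpa only [abs_neg, abs_of_nonneg h0] using norm_invCharFun_mul_exp_sub_one_le (-x) hθ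

end CharFun

/-! ### A local limit theorem for systems of linear equations -/

section Chord

/-- The length `|e^{ix} - 1|` of a chord of the unit circle. -/
noncomputable def chord : AddGroupSeminorm ℝ where
  toFun x := ‖Complex.exp (x * Complex.I) - 1‖
  map_zero' := by simp
  add_le' x y := by
    have hsplit : Complex.exp ((x + y : ℝ) * Complex.I) - 1 =
        (Complex.exp (x * Complex.I) - 1)
          + Complex.exp (x * Complex.I) * (Complex.exp (y * Complex.I) - 1) := by
      push_cast
      rw [add_mul, Complex.exp_add]
      ring
    rw [hsplit]
    refine (norm_add_le _ _).trans_eq ?_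
    rw [norm_mul, Complex.norm_exp_ofReal_mul_I, one_mul]
  neg' x := by
    have hsplit : Complex.exp ((-x : ℝ) * Complex.I) - 1 =
        -(Complex.exp ((-x : ℝ) * Complex.I) * (Complex.exp (x * Complex.I) - 1)) := by
      rw [mul_sub, ← Complex.exp_add]
      simp
    rw [hsplit, norm_neg, norm_mul, Complex.norm_exp_ofReal_mul_I, one_mul]

lemma chord_sq (x : ℝ) : chord x ^ 2 = 2 * (1 - Real.cos x) := by
  have hreim : (Complex.exp (x * Complex.I) - 1 : ℂ) = ⟨Real.cos x - 1, Real.sin x⟩ := by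
    rw [Complex.exp_mul_I]
    apply Complex.ext <;> simp [Complex.cos_ofReal_re, Complex.sin_ofReal_re]
  change ‖Complex.exp (x * Complex.I) - 1‖ ^ 2 = _
  rw [hreim, ← Complex.normSq_eq_norm_sq, Complex.normSq_mk]
  linear_combination Real.sin_sq_add_cos_sq x

lemma sq_le_mul_chord_sq {x : ℝ} (hx : |x| ≤ Real.pi) :
    x ^ 2 ≤ Real.pi ^ 2 / 4 * chord x ^ 2 := by
  have hcos : 2 / Real.pi ^ 2 * x ^ 2 ≤ 1 - Real.cos x := by
    linarith [Real.cos_le_one_sub_mul_cos_sq hx]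
  rw [chord_sq]
  calc x ^ 2 = Real.pi ^ 2 / 4 * (2 * (2 / Real.pi ^ 2 * x ^ 2)) := by
        field_simp [Real.pi_ne_zero]
        ring
    _ ≤ _ := by gcongr

end Chord

lemma abs_weightedMatrix_mul_transpose_le {D J : Type} [Fintype J] {A : Matrix D J ℤ}
    {w : J → ℝ} {W : ℝ} (hA : ∀ c j, |(A c j : ℝ)| ≤ 1) (hw0 : ∀ j, 0 ≤ w j) (hw : ∀ j, w j ≤ W)
    (c c' : D) :
    |(weightedMatrix A w * (weightedMatrix A w)ᵀ) c c'| ≤ Fintype.card J * W := by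
  rw [mul_apply, ← nsmul_eq_mul]
  refine (Finset.abs_sum_le_sum_abs _ _).trans (Finset.sum_le_card_nsmul _ _ W fun j _ => ?_)
  calc |weightedMatrix A w c j * (weightedMatrix A w)ᵀ j c'|
      = w j * (|(A c j : ℝ)| * |(A c' j : ℝ)|) := by
        simp only [weightedMatrix, transpose_apply, of_apply]
        rw [mul_mul_mul_comm, Real.mul_self_sqrt (hw0 j), abs_mul, abs_mul, abs_of_nonneg (hw0 j)]
    _ ≤ w j * (1 * 1) := by
        gcongr
        exacts [hw0 j, hA c j, hA c' j]
    _ ≤ W := by simpa using hw j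

section LocalLimit

variable {D J : Type} [Fintype D] {A : Matrix D J ℤ}

lemma abs_linForm_le {ρ T : ℝ} (hρ : ∀ j, ∑ c, |(A c j : ℝ)| ≤ ρ) (hT : 0 ≤ T) {t : D → ℝ}
    (ht : ∀ c, |t c| ≤ T) (j : J) : |linForm A t j| ≤ ρ * T :=
  calc |linForm A t j| ≤ ∑ c, |(A c j : ℝ)| * |t c| := by
        simp only [linForm, ← abs_mul]
        exact Finset.abs_sum_le_sum_abs _ _
    _ ≤ ∑ c, |(A c j : ℝ)| * T := by gcongr with c; exact ht c
    _ ≤ ρ * T := by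
        rw [← Finset.sum_mul]
        exact mul_le_mul_of_nonneg_right (hρ j) hT

variable [Fintype J]

/-- Every coordinate of `t` is controlled in quadratic mean by the linear forms given by the
columns of `A`, with respect to every seminorm on the additive group of the reals. The absolute
value is used close to the origin, and `chord` on the whole torus. -/
structure CoordBound (A : Matrix D J ℤ) (γ : ℝ) : Prop where
  nonneg : 0 ≤ γ
  sq_le (f : AddGroupSeminorm ℝ) (t : D → ℝ) (c : D) :
    f (t c) ^ 2 ≤ γ * ∑ j, f (linForm A t j) ^ 2

/-- The quadratic form of `B Bᵀ`, where `B` has columns `√(w j) a_j`. -/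
def quadForm (A : Matrix D J ℤ) (w : J → ℝ) (t : D → ℝ) : ℝ := ∑ j, w j * linForm A t j ^ 2

/-- The ellipsoid of all `t` at which the squares of the linear forms given by the columns of `A`
sum to at most `s`. -/
def formBall (A : Matrix D J ℤ) (s : ℝ) : Set (D → ℝ) := {t | ∑ j, linForm A t j ^ 2 ≤ s}

lemma measurableSet_formBall (s : ℝ) : MeasurableSet (formBall A s) :=
  (isClosed_le (by fun_prop) continuous_const).measurableSet

lemma mul_sum_sq_le_quadForm {w : J → ℝ} {w₀ : ℝ} (hw : ∀ j, w₀ ≤ w j) (t : D → ℝ) :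
    w₀ * ∑ j, linForm A t j ^ 2 ≤ quadForm A w t := by
  rw [Finset.mul_sum]
  exact Finset.sum_le_sum fun j _ => mul_le_mul_of_nonneg_right (hw j) (sq_nonneg _)

lemma abs_coord_le {γ s : ℝ} (hA : CoordBound A γ) {t : D → ℝ} (ht : t ∈ formBall A s) (c : D) :
    |t c| ≤ √(γ * s) := by
  refine Real.abs_le_sqrt ?_
  have hsq : |t c| ^ 2 ≤ γ * ∑ j, |linForm A t j| ^ 2 := hA.sq_le (normAddGroupSeminorm ℝ) t c
  simp only [sq_abs] at hsq
  exact hsq.trans (mul_le_mul_of_nonneg_left ht hA.nonneg)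

lemma mem_formBall_of_chord {γ ρ s : ℝ} (hA : CoordBound A γ)
    (hρ : ∀ j, ∑ c, |(A c j : ℝ)| ≤ ρ) (hs : ρ * √(γ * s) ≤ 1) {t : D → ℝ} (ht : t ∈ torusCube D)
    (hchord : ∑ j, chord (linForm A t j) ^ 2 ≤ 4 / Real.pi ^ 2 * s) : t ∈ formBall A s := by
  have hpi := Real.pi_pos
  have hcoord (c : D) : |t c| ≤ √(γ * s) := by
    have htc := ht c (Set.mem_univ c)
    refine Real.abs_le_sqrt ((sq_le_mul_chord_sq (abs_le.mpr ⟨htc.1.le, htc.2⟩)).trans ?_)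
    calc Real.pi ^ 2 / 4 * chord (t c) ^ 2
        ≤ Real.pi ^ 2 / 4 * (γ * (4 / Real.pi ^ 2 * s)) := by
          gcongr
          exact (hA.sq_le chord t c).trans (mul_le_mul_of_nonneg_left hchord hA.nonneg)
      _ = γ * s := by field_simp
  have hform (j : J) : |linForm A t j| ≤ Real.pi :=
    (abs_linForm_le hρ (Real.sqrt_nonneg _) hcoord j).trans
      (hs.trans (by linarith [Real.pi_gt_three]))
  calc ∑ j, linForm A t j ^ 2 ≤ Real.pi ^ 2 / 4 * ∑ j, chord (linForm A t j) ^ 2 := by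
        rw [Finset.mul_sum]
        exact Finset.sum_le_sum fun j _ => sq_le_mul_chord_sq (hform j)
    _ ≤ Real.pi ^ 2 / 4 * (4 / Real.pi ^ 2 * s) := by gcongr
    _ = s := by field_simp

lemma formBall_subset_torusCube {γ ρ s : ℝ} (hA : CoordBound A γ) (hρ1 : 1 ≤ ρ)
    (hs : ρ * √(γ * s) ≤ 1) : formBall A s ⊆ torusCube D := fun t ht c _ => by
  have hsqrt : √(γ * s) ≤ 1 := by nlinarith [Real.sqrt_nonneg (γ * s)]
  have habs := abs_le.mp ((abs_coord_le hA ht c).trans hsqrt)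
  have hpi := Real.pi_gt_three
  exact ⟨by linarith, by linarith⟩

section Gaussian

variable {w : J → ℝ}

/-- The constant `(2π)^{d/2} (det B Bᵀ)^{1/2}`, where `B` has columns `√(w j) a_j`. -/
noncomputable def gaussianNorm [DecidableEq D] (A : Matrix D J ℤ) (w : J → ℝ) : ℝ :=
  (2 * Real.pi) ^ ((Fintype.card D : ℝ) / 2) *
    √(weightedMatrix A w * (weightedMatrix A w)ᵀ).det

lemma gaussianNorm_eq [DecidableEq D] (A : Matrix D J ℤ) (w : J → ℝ) :
    gaussianNorm A w = √(2 * Real.pi) ^ Fintype.card D *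
      √(weightedMatrix A w * (weightedMatrix A w)ᵀ).det := by
  rw [gaussianNorm, Real.rpow_div_two_eq_sqrt _ (by positivity), Real.rpow_natCast]

lemma dotProduct_weightedMatrix_mulVec (hw : ∀ j, 0 ≤ w j) (t : D → ℝ) :
    t ⬝ᵥ (weightedMatrix A w * (weightedMatrix A w)ᵀ) *ᵥ t = quadForm A w t := by
  rw [← mulVec_mulVec, dotProduct_mulVec, ← mulVec_transpose, dotProduct]
  refine Finset.sum_congr rfl fun j _ => ?_
  have hcoord : ((weightedMatrix A w)ᵀ *ᵥ t) j = √(w j) * linForm A t j := by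
    simp only [mulVec, dotProduct, transpose_apply, weightedMatrix, of_apply, linForm,
      Finset.mul_sum, mul_assoc]
  rw [hcoord, mul_mul_mul_comm, Real.mul_self_sqrt (hw j), sq]

lemma posDef_weightedMatrix {γ : ℝ} (hA : CoordBound A γ) (hw : ∀ j, 0 < w j) :
    (weightedMatrix A w * (weightedMatrix A w)ᵀ).PosDef := by
  refine posDef_iff_dotProduct_mulVec.mpr ⟨?_, fun t ht => ?_⟩
  · rw [← conjTranspose_eq_transpose_of_trivial]
    exact isHermitian_mul_conjTranspose_self _
  rw [star_trivial, dotProduct_weightedMatrix_mulVec fun j => (hw j).le]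
  have hterm (j : J) : 0 ≤ w j * linForm A t j ^ 2 := mul_nonneg (hw j).le (sq_nonneg _)
  refine (Finset.sum_nonneg fun j _ => hterm j).lt_of_ne' fun h => ht (funext fun c => ?_)
  have hform (j : J) : linForm A t j = 0 := by
    simpa [(hw j).ne'] using
      (Finset.sum_eq_zero_iff_of_nonneg fun j _ => hterm j).mp h j (Finset.mem_univ j)
  have hball : t ∈ formBall A 0 := by simp [formBall, hform]
  simpa using abs_coord_le hA hball c

lemma gaussianNorm_pos [DecidableEq D]
    (hQ : (weightedMatrix A w * (weightedMatrix A w)ᵀ).PosDef) : 0 < gaussianNorm A w :=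
  mul_pos (by positivity) (Real.sqrt_pos.mpr hQ.det_pos)

lemma gaussianNorm_sq_le [DecidableEq D] {W : ℝ} (hA : ∀ c j, |(A c j : ℝ)| ≤ 1)
    (hw0 : ∀ j, 0 ≤ w j) (hw : ∀ j, w j ≤ W) (hW : 0 ≤ W) :
    gaussianNorm A w ^ 2 ≤
      (2 * Real.pi * (Fintype.card D * (Fintype.card J * W))) ^ Fintype.card D := by
  have hdet : 0 ≤ (weightedMatrix A w * (weightedMatrix A w)ᵀ).det := by
    rw [← conjTranspose_eq_transpose_of_trivial]
    exact (posSemidef_self_mul_conjTranspose _).det_nonneg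
  rw [gaussianNorm_eq, mul_pow, Real.sq_sqrt hdet, ← pow_mul, mul_comm _ 2, pow_mul,
    Real.sq_sqrt (by positivity), mul_pow (2 * Real.pi), mul_pow (Fintype.card D : ℝ)]
  gcongr
  refine (le_abs_self _).trans ((det_le (abv := AbsoluteValue.abs)
    (abs_weightedMatrix_mul_transpose_le hA hw0 hw)).trans ?_)
  rw [nsmul_eq_mul]
  gcongr
  exact_mod_cast Nat.factorial_le_pow _

variable (hQ : (weightedMatrix A w * (weightedMatrix A w)ᵀ).PosDef) (hw : ∀ j, 0 ≤ w j)
include hQ hw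

lemma integrable_exp_neg_mul_quadForm {a : ℝ} (ha : 0 < a) :
    Integrable fun t => Real.exp (-a * quadForm A w t) := by
  simpa only [dotProduct_weightedMatrix_mulVec hw] using integrable_exp_neg_mul_quadratic hQ ha

variable [DecidableEq D]

lemma integral_exp_neg_half_mul_quadForm :
    ∫ t, Real.exp (-(1 / 2) * quadForm A w t) =
      (2 * Real.pi) ^ Fintype.card D / gaussianNorm A w := by
  have hdet : √(weightedMatrix A w * (weightedMatrix A w)ᵀ).det ≠ 0 :=
    (Real.sqrt_pos.mpr hQ.det_pos).ne'
  simp_rw [← dotProduct_weightedMatrix_mulVec hw]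
  rw [integral_exp_neg_mul_quadratic hQ, gaussianNorm_eq, div_div_eq_mul_div, div_one,
    mul_comm Real.pi 2, div_eq_div_iff hdet (by positivity), ← mul_assoc, ← mul_pow,
    Real.mul_self_sqrt (by positivity)]

lemma integral_exp_neg_quarter_mul_quadForm :
    ∫ t, Real.exp (-(1 / 4) * quadForm A w t) =
      √2 ^ Fintype.card D * ((2 * Real.pi) ^ Fintype.card D / gaussianNorm A w) := by
  rw [← integral_exp_neg_half_mul_quadForm hQ hw]
  simp_rw [← dotProduct_weightedMatrix_mulVec hw]
  rw [integral_exp_neg_mul_quadratic hQ, integral_exp_neg_mul_quadratic hQ, ← mul_div_assoc,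
    ← mul_pow, ← Real.sqrt_mul (by norm_num), show Real.pi / (1 / 4) = 2 * (Real.pi / (1 / 2)) by
      ring]

lemma setIntegral_compl_formBall_exp_le {w₀ : ℝ} (hw₀ : 0 ≤ w₀) (hww : ∀ j, w₀ ≤ w j) (s : ℝ) :
    ∫ t in (formBall A s)ᶜ, Real.exp (-(1 / 2) * quadForm A w t) ≤
      Real.exp (-(w₀ / 4 * s)) *
        (√2 ^ Fintype.card D * ((2 * Real.pi) ^ Fintype.card D / gaussianNorm A w)) := by
  have hhalf := integrable_exp_neg_mul_quadForm hQ hw (a := 1 / 2) (by norm_num)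
  have hquarter := integrable_exp_neg_mul_quadForm hQ hw (a := 1 / 4) (by norm_num)
  calc _ ≤ ∫ t in (formBall A s)ᶜ,
          Real.exp (-(w₀ / 4 * s)) * Real.exp (-(1 / 4) * quadForm A w t) := by
        refine setIntegral_mono_on hhalf.integrableOn (hquarter.integrableOn.const_mul _)
          (measurableSet_formBall s).compl fun t ht => ?_
        rw [← Real.exp_add, Real.exp_le_exp]
        have hout : s ≤ ∑ j, linForm A t j ^ 2 := (not_le.mp (show ¬ _ ≤ s from ht)).le
        have hform := mul_sum_sq_le_quadForm (A := A) hww t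
        nlinarith
    _ = Real.exp (-(w₀ / 4 * s)) *
          ∫ t in (formBall A s)ᶜ, Real.exp (-(1 / 4) * quadForm A w t) := integral_const_mul _ _
    _ ≤ _ := by
        rw [← integral_exp_neg_quarter_mul_quadForm hQ hw]
        exact mul_le_mul_of_nonneg_left
          (setIntegral_le_integral hquarter (.of_forall fun t => Real.exp_nonneg _))
          (Real.exp_nonneg _)

end Gaussian

variable {μ : J → Measure ℕ} {z w : J → ℝ} {κ L : ℝ}

/-- The integrand of the Fourier inversion formula `measureReal_linear_system`. -/
noncomputable def fourierIntegrand (A : Matrix D J ℤ) (μ : J → Measure ℕ) (b : D → ℤ)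
    (t : D → ℝ) : ℂ :=
  (∏ j, natCharFun (μ j) (linForm A t j)) * Complex.exp (-(Complex.I * (∑ c, t c * b c : ℝ)))

lemma continuous_fourierIntegrand [∀ j, IsFiniteMeasure (μ j)] (b : D → ℤ) :
    Continuous (fourierIntegrand A μ b) := by
  have hchar (j : J) : Continuous fun t => natCharFun (μ j) (linForm A t j) :=
    (continuous_natCharFun (μ j)).comp (continuous_linForm A j)
  unfold fourierIntegrand
  fun_prop

variable (hμ : ∀ j, IsNearGaussian (μ j) (z j) (w j) κ L)
include hμ

lemma norm_fourierIntegrand_le (b : D → ℤ) (t : D → ℝ) :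
    ‖fourierIntegrand A μ b t‖ ≤ Real.exp (-(κ / 2 * ∑ j, chord (linForm A t j) ^ 2)) := by
  have hphase : ‖Complex.exp (-(Complex.I * (∑ c, t c * b c : ℝ)))‖ = 1 := by
    rw [mul_comm, ← neg_mul, ← Complex.ofReal_neg, Complex.norm_exp_ofReal_mul_I]
  rw [fourierIntegrand, norm_mul, norm_prod, hphase, mul_one]
  calc ∏ j, ‖natCharFun (μ j) (linForm A t j)‖
      ≤ ∏ j, Real.exp (-(κ * (1 - Real.cos (linForm A t j)))) :=
        Finset.prod_le_prod (fun j _ => norm_nonneg _) fun j _ => (hμ j).norm_natCharFun_le _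
    _ = _ := by
        rw [← Real.exp_sum, Finset.mul_sum, ← Finset.sum_neg_distrib]
        refine congrArg _ (Finset.sum_congr rfl fun j _ => ?_)
        rw [chord_sq]
        ring

lemma integrableOn_fourierIntegrand [∀ j, IsFiniteMeasure (μ j)] (hκ : 0 ≤ κ) (b : D → ℤ) :
    IntegrableOn (fourierIntegrand A μ b) (torusCube D) := by
  refine Integrable.of_bound (continuous_fourierIntegrand b).aestronglyMeasurable 1
    (.of_forall fun t => (norm_fourierIntegrand_le hμ b t).trans ?_)
  rw [Real.exp_le_one_iff, neg_nonpos]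
  positivity

lemma norm_setIntegral_sdiff_fourierIntegrand_le {γ ρ s : ℝ} (hκ : 0 ≤ κ) (hA : CoordBound A γ)
    (hρ : ∀ j, ∑ c, |(A c j : ℝ)| ≤ ρ) (hs : ρ * √(γ * s) ≤ 1) (b : D → ℤ) :
    ‖∫ t in torusCube D \ formBall A s, fourierIntegrand A μ b t‖ ≤
      Real.exp (-(2 * κ / Real.pi ^ 2 * s)) * (2 * Real.pi) ^ Fintype.card D := by
  have hfin : volume (torusCube D) < ⊤ := by
    rw [volume_torusCube]
    exact ENNReal.pow_lt_top ENNReal.ofReal_lt_top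
  have hfar (t) (ht : t ∈ torusCube D \ formBall A s) :
      ‖fourierIntegrand A μ b t‖ ≤ Real.exp (-(2 * κ / Real.pi ^ 2 * s)) := by
    have hchord : 4 / Real.pi ^ 2 * s ≤ ∑ j, chord (linForm A t j) ^ 2 := by
      by_contra! h
      exact ht.2 (mem_formBall_of_chord hA hρ hs ht.1 h.le)
    refine (norm_fourierIntegrand_le hμ b t).trans (Real.exp_le_exp.mpr (neg_le_neg ?_))
    calc 2 * κ / Real.pi ^ 2 * s = κ / 2 * (4 / Real.pi ^ 2 * s) := by ring
      _ ≤ _ := by gcongr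
  rw [← volumeReal_torusCube]
  refine (norm_setIntegral_le_of_norm_le_const
    ((measure_mono Set.sdiff_subset).trans_lt hfin) hfar).trans ?_
  exact mul_le_mul_of_nonneg_left (measureReal_mono Set.sdiff_subset hfin.ne) (Real.exp_nonneg _)

lemma ofReal_measureReal_linear_system_sub_eq [DecidableEq D] [∀ j, IsProbabilityMeasure (μ j)]
    {b : D → ℤ} {γ ρ s : ℝ} (hκ : 0 ≤ κ) (hA : CoordBound A γ) (hρ1 : 1 ≤ ρ)
    (hs : ρ * √(γ * s) ≤ 1) (hw : ∀ j, 0 < w j) :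
    (((Measure.pi μ).real {x | A *ᵥ (fun j => (x j : ℤ)) = b} * (2 * Real.pi) ^ Fintype.card D
        - (2 * Real.pi) ^ Fintype.card D / gaussianNorm A w : ℝ) : ℂ) =
      ((∫ t in formBall A s, fourierIntegrand A μ b t) -
          ((∫ t in formBall A s, Real.exp (-(1 / 2) * quadForm A w t) : ℝ) : ℂ))
        - ((∫ t in (formBall A s)ᶜ, Real.exp (-(1 / 2) * quadForm A w t) : ℝ) : ℂ)
        + ∫ t in torusCube D \ formBall A s, fourierIntegrand A μ b t := by
  have hQ := posDef_weightedMatrix hA hw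
  have hfourier := measureReal_linear_system A μ b
  rw [setIntegral_sdiff (measurableSet_formBall s) (integrableOn_fourierIntegrand hμ hκ b)
    (formBall_subset_torusCube hA hρ1 hs),
    ← integral_exp_neg_half_mul_quadForm hQ fun j => (hw j).le,
    ← integral_add_compl (measurableSet_formBall (A := A) s)
      (integrable_exp_neg_mul_quadForm hQ (fun j => (hw j).le) (by norm_num))]
  push_cast
  rw [hfourier]
  simp only [fourierIntegrand]
  ring

variable {b : D → ℤ} (hb : A.map (Int.cast : ℤ → ℝ) *ᵥ z = fun c => (b c : ℝ))
include hb

lemma norm_fourierIntegrand_sub_le {T : ℝ} (hL : 0 ≤ L) (hT1 : T ≤ 1) {t : D → ℝ}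
    (ht : ∀ j, |linForm A t j| ≤ T) :
    ‖fourierIntegrand A μ b t - (Real.exp (-(1 / 2) * quadForm A w t) : ℝ)‖ ≤
      (Real.exp (L * (T * ∑ j, linForm A t j ^ 2)) - 1) *
        Real.exp (-(1 / 2) * quadForm A w t) := by
  let u : J → ℂ := fun j => natCharFun (μ j) (linForm A t j) *
    Complex.exp (-(Complex.I * (z j * linForm A t j)) + w j * linForm A t j ^ 2 / 2) - 1
  have hphase : ∑ c, t c * (b c : ℝ) = ∑ j, z j * linForm A t j := by
    simpa only [hb, mul_comm (linForm A t _)] using (sum_linForm_mul A t z).symm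
  have hfactor : fourierIntegrand A μ b t =
      (Real.exp (-(1 / 2) * quadForm A w t) : ℝ) * ∏ j, (1 + u j) := by
    simp only [u, add_sub_cancel, fourierIntegrand, hphase, quadForm]
    rw [Finset.prod_mul_distrib, ← Complex.exp_sum, Complex.ofReal_exp, mul_left_comm,
      ← Complex.exp_add]
    congr 2
    push_cast
    simp only [Finset.mul_sum, ← Finset.sum_add_distrib, ← Finset.sum_neg_distrib]
    exact Finset.sum_congr rfl fun j _ => by ring
  have hu : ∑ j, ‖u j‖ ≤ L * (T * ∑ j, linForm A t j ^ 2) := by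
    rw [Finset.mul_sum, Finset.mul_sum]
    refine Finset.sum_le_sum fun j _ =>
      ((hμ j).norm_natCharFun_mul_exp_sub_one_le ((ht j).trans hT1)).trans ?_
    rw [pow_succ', ← sq_abs (linForm A t j)]
    gcongr
    exact ht j
  rw [hfactor, ← mul_sub_one, norm_mul, Complex.norm_real, Real.norm_of_nonneg (Real.exp_nonneg _),
    mul_comm]
  refine mul_le_mul_of_nonneg_right ?_ (Real.exp_nonneg _)
  exact (Finset.norm_prod_one_add_sub_one_le _ _).trans
    (sub_le_sub_right (Real.exp_le_exp.mpr hu) 1)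

variable [DecidableEq D] [∀ j, IsProbabilityMeasure (μ j)]

lemma norm_setIntegral_formBall_sub_le {γ ρ s : ℝ} (hκ : 0 ≤ κ) (hL : 0 ≤ L) (hA : CoordBound A γ)
    (hρ : ∀ j, ∑ c, |(A c j : ℝ)| ≤ ρ) (hρ1 : 1 ≤ ρ) (hs0 : 0 ≤ s) (hs : ρ * √(γ * s) ≤ 1)
    (hw : ∀ j, 0 < w j) :
    ‖(∫ t in formBall A s, fourierIntegrand A μ b t) -
        ((∫ t in formBall A s, Real.exp (-(1 / 2) * quadForm A w t) : ℝ) : ℂ)‖ ≤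
      (Real.exp (L * (ρ * √(γ * s) * s)) - 1) *
        ((2 * Real.pi) ^ Fintype.card D / gaussianNorm A w) := by
  have hQ := posDef_weightedMatrix hA hw
  have hE := integrable_exp_neg_mul_quadForm hQ (fun j => (hw j).le) (a := 1 / 2) (by norm_num)
  have hη : 0 ≤ Real.exp (L * (ρ * √(γ * s) * s)) - 1 :=
    sub_nonneg.mpr (Real.one_le_exp (by positivity))
  have hF : IntegrableOn (fourierIntegrand A μ b) (formBall A s) :=
    (integrableOn_fourierIntegrand hμ hκ b).mono_set (formBall_subset_torusCube hA hρ1 hs)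
  have hEc : IntegrableOn (fun t => ((Real.exp (-(1 / 2) * quadForm A w t) : ℝ) : ℂ))
      (formBall A s) := hE.integrableOn.ofReal
  rw [← integral_complex_ofReal, ← integral_sub hF hEc]
  calc _ ≤ ∫ t in formBall A s, (Real.exp (L * (ρ * √(γ * s) * s)) - 1) *
          Real.exp (-(1 / 2) * quadForm A w t) := by
        refine norm_integral_le_of_norm_le (hE.integrableOn.const_mul _)
          ((ae_restrict_iff' (measurableSet_formBall s)).mpr (.of_forall fun t ht => ?_))
        have hform := abs_linForm_le hρ (Real.sqrt_nonneg _) fun c => abs_coord_le hA ht c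
        refine (norm_fourierIntegrand_sub_le hμ hb hL hs hform).trans ?_
        gcongr
        exact ht
    _ = (Real.exp (L * (ρ * √(γ * s) * s)) - 1) *
          ∫ t in formBall A s, Real.exp (-(1 / 2) * quadForm A w t) := integral_const_mul _ _
    _ ≤ _ := by
        rw [← integral_exp_neg_half_mul_quadForm hQ fun j => (hw j).le]
        exact mul_le_mul_of_nonneg_left
          (setIntegral_le_integral hE (.of_forall fun t => Real.exp_nonneg _)) hη

theorem abs_measureReal_linear_system_mul_gaussianNorm_sub_one_le {γ ρ s w₀ : ℝ} (hκ : 0 ≤ κ)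
    (hL : 0 ≤ L) (hA : CoordBound A γ) (hρ : ∀ j, ∑ c, |(A c j : ℝ)| ≤ ρ) (hρ1 : 1 ≤ ρ)
    (hs0 : 0 ≤ s) (hs : ρ * √(γ * s) ≤ 1) (hw₀ : 0 < w₀) (hw : ∀ j, w₀ ≤ w j) :
    |(Measure.pi μ).real {x | A *ᵥ (fun j => (x j : ℤ)) = b} * gaussianNorm A w - 1| ≤
      (Real.exp (L * (ρ * √(γ * s) * s)) - 1)
        + Real.exp (-(w₀ / 4 * s)) * √2 ^ Fintype.card D
        + Real.exp (-(2 * κ / Real.pi ^ 2 * s)) * gaussianNorm A w := by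
  have hw0 (j : J) : 0 < w j := hw₀.trans_le (hw j)
  have hQ := posDef_weightedMatrix hA hw0
  have hR := gaussianNorm_pos hQ
  have hG : 0 < (2 * Real.pi) ^ Fintype.card D / gaussianNorm A w := by positivity
  have htail : ‖((∫ t in (formBall A s)ᶜ, Real.exp (-(1 / 2) * quadForm A w t) : ℝ) : ℂ)‖ ≤
      Real.exp (-(w₀ / 4 * s)) *
        (√2 ^ Fintype.card D * ((2 * Real.pi) ^ Fintype.card D / gaussianNorm A w)) := by
    rw [Complex.norm_real, Real.norm_of_nonneg (integral_nonneg fun t => Real.exp_nonneg _)]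
    exact setIntegral_compl_formBall_exp_le hQ (fun j => (hw0 j).le) hw₀.le hw s
  have hcentral := norm_setIntegral_formBall_sub_le hμ hb hκ hL hA hρ hρ1 hs0 hs hw0
  have hfar := norm_setIntegral_sdiff_fourierIntegrand_le hμ hκ hA hρ hs b
  have htotal := (norm_add_le _ _).trans
    (add_le_add ((norm_sub_le _ _).trans (add_le_add hcentral htail)) hfar)
  rw [← ofReal_measureReal_linear_system_sub_eq hμ hκ hA hρ1 hs hw0, Complex.norm_real,
    Real.norm_eq_abs] at htotal
  refine le_of_mul_le_mul_right ?_ hG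
  rw [← abs_of_pos hG, ← abs_mul, abs_of_pos hG]
  convert htotal using 1
  · congr 1
    field_simp
  · field_simp

end LocalLimit

/-! ### The equations of multi-way tables -/

section SumUpdate

variable {ι : Type*} {π : ι → Type*} [Fintype ι] [DecidableEq ι] [∀ i, Fintype (π i)]

lemma sum_comp_update_le {F : (∀ i, π i) → ℝ} (hF : ∀ p, 0 ≤ F p) (i : ι) (a : π i) :
    ∑ p, F (Function.update p i a) ≤ Fintype.card (π i) * ∑ p, F p := by
  classical
  let e : (∀ i, π i) → π i × ∀ i, π i := fun p => (p i, Function.update p i a)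
  have he : Function.Injective e := fun p q h => by
    calc p = Function.update (e p).2 i (e p).1 := by simp [e]
      _ = Function.update (e q).2 i (e q).1 := by rw [h]
      _ = q := by simp [e]
  calc ∑ p, F (Function.update p i a) = ∑ x ∈ Finset.univ.image e, F x.2 :=
        (Finset.sum_image (f := fun x => F x.2) he.injOn).symm
    _ ≤ ∑ x : π i × ∀ i, π i, F x.2 :=
        Finset.sum_le_univ_sum_of_nonneg fun x => hF x.2
    _ = Fintype.card (π i) * ∑ p, F p := by
        simp [Fintype.sum_prod_type]

end SumUpdate

section Table

variable {ν : ℕ} {k : Fin ν → ℕ}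

/-- The coordinate of `t` that belongs to the section `j` in direction `i`, which is `0` for the
last section. -/
def sectionCoord (k : Fin ν → ℕ) (t : Constraint k → ℝ) (i : Fin ν) (j : Fin (k i)) : ℝ :=
  if h : (j : ℕ) < k i - 1 then t (some ⟨i, ⟨j, h⟩⟩) else 0

lemma linForm_tableMatrix (t : Constraint k → ℝ) (p : Cell k) :
    linForm (tableMatrix k) t p = t none + ∑ i, sectionCoord k t i (p i) := by
  rw [linForm, Fintype.sum_option, Fintype.sum_sigma]
  congr 1
  · simp [tableMatrix]
  refine Finset.sum_congr rfl fun i _ => ?_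
  simp only [tableMatrix, of_apply, sectionCoord]
  split_ifs with h
  · rw [Finset.sum_eq_single ⟨p i, h⟩ (fun j _ hj => ?_) (by simp)]
    · simp
    · rw [if_neg fun e => hj (Fin.ext e.symm), Int.cast_zero, zero_mul]
  · refine Finset.sum_eq_zero fun j _ => ?_
    rw [if_neg fun e : (p i : ℕ) = j => h (e ▸ j.2), Int.cast_zero, zero_mul]

lemma tableMatrix_nonneg (c : Constraint k) (p : Cell k) : 0 ≤ tableMatrix k c p := by
  rcases c with _ | ⟨i, j⟩
  · simp [tableMatrix]
  · simp only [tableMatrix, of_apply]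
    split_ifs <;> simp

lemma abs_tableMatrix_le_one (c : Constraint k) (p : Cell k) : |(tableMatrix k c p : ℝ)| ≤ 1 := by
  rcases c with _ | ⟨i, j⟩
  · simp [tableMatrix]
  · simp only [tableMatrix, of_apply]
    split_ifs <;> simp

lemma sum_abs_tableMatrix_le (p : Cell k) : ∑ c, |(tableMatrix k c p : ℝ)| ≤ ν + 1 := by
  have hnonneg (c : Constraint k) : (0 : ℝ) ≤ tableMatrix k c p := by
    exact_mod_cast tableMatrix_nonneg c p
  have hsection (i : Fin ν) : sectionCoord k 1 i (p i) ≤ 1 := by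
    rw [sectionCoord]
    split_ifs <;> simp
  calc ∑ c, |(tableMatrix k c p : ℝ)| = linForm (tableMatrix k) 1 p := by
        simp [linForm, abs_of_nonneg (hnonneg _)]
    _ = 1 + ∑ i, sectionCoord k 1 i (p i) := linForm_tableMatrix 1 p
    _ ≤ 1 + ∑ _i : Fin ν, 1 := by gcongr with i; exact hsection i
    _ = ν + 1 := by simp [add_comm]

section CoordBound

variable {m : ℝ} (hk : ∀ i, 0 < k i) (f : AddGroupSeminorm ℝ) (t : Constraint k → ℝ)
include hk

lemma sectionCoord_sq_le (hm : ∀ i, (k i : ℝ) ≤ m * Fintype.card (Cell k)) (i : Fin ν)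
    (j : Fin (k i)) :
    f (sectionCoord k t i j) ^ 2 ≤ 4 * (m * ∑ p, f (linForm (tableMatrix k) t p) ^ 2) := by
  have hne (i : Fin ν) : Nonempty (Fin (k i)) := ⟨⟨0, hk i⟩⟩
  have hK : 0 < (Fintype.card (Cell k) : ℝ) := Nat.cast_pos.mpr Fintype.card_pos
  let F : Cell k → ℝ := fun p => f (linForm (tableMatrix k) t p) ^ 2
  let last : Fin (k i) := ⟨k i - 1, Nat.sub_one_lt (hk i).ne'⟩
  have hdiff (p : Cell k) : sectionCoord k t i j =
      linForm (tableMatrix k) t (Function.update p i j)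
        - linForm (tableMatrix k) t (Function.update p i last) := by
    rw [linForm_tableMatrix, linForm_tableMatrix, add_sub_add_left_eq_sub,
      ← Finset.sum_sub_distrib, Finset.sum_eq_single i]
    · simp [sectionCoord, last]
    · intro i' _ hi'
      rw [Function.update_of_ne hi', Function.update_of_ne hi', sub_self]
    · simp
  have hpoint (p : Cell k) : f (sectionCoord k t i j) ^ 2 ≤
      2 * (F (Function.update p i j) + F (Function.update p i last)) := by
    rw [hdiff p]
    exact (pow_le_pow_left₀ (apply_nonneg f _) (map_sub_le_add f _ _) 2).trans add_sq_le
  have hslice (a : Fin (k i)) :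
      ∑ p, F (Function.update p i a) ≤ m * Fintype.card (Cell k) * ∑ p, F p := by
    have hF (p : Cell k) : 0 ≤ F p := sq_nonneg _
    refine (sum_comp_update_le hF i a).trans ?_
    rw [Fintype.card_fin]
    exact mul_le_mul_of_nonneg_right (hm i) (Finset.sum_nonneg fun p _ => hF p)
  refine le_of_mul_le_mul_left ?_ hK
  calc Fintype.card (Cell k) * f (sectionCoord k t i j) ^ 2
      = ∑ _p : Cell k, f (sectionCoord k t i j) ^ 2 := by simp
    _ ≤ ∑ p, 2 * (F (Function.update p i j) + F (Function.update p i last)) :=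
        Finset.sum_le_sum fun p _ => hpoint p
    _ ≤ Fintype.card (Cell k) * (4 * (m * ∑ p, F p)) := by
        rw [← Finset.mul_sum, Finset.sum_add_distrib]
        linarith [hslice j, hslice last]

lemma exists_sq_linForm_tableMatrix_le (hm : 1 ≤ m * Fintype.card (Cell k)) :
    ∃ p, f (linForm (tableMatrix k) t p) ^ 2 ≤
      m * ∑ p, f (linForm (tableMatrix k) t p) ^ 2 := by
  have hne (i : Fin ν) : Nonempty (Fin (k i)) := ⟨⟨0, hk i⟩⟩
  obtain ⟨p, -, hp⟩ := Finset.exists_le_of_sum_le (s := Finset.univ) Finset.univ_nonempty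
    (f := fun p => f (linForm (tableMatrix k) t p) ^ 2)
    (g := fun _ => m * ∑ p, f (linForm (tableMatrix k) t p) ^ 2) (by
      rw [Finset.sum_const, Finset.card_univ, nsmul_eq_mul, ← mul_assoc, mul_comm _ m]
      exact le_mul_of_one_le_left (Finset.sum_nonneg fun p _ => sq_nonneg _) hm)
  exact ⟨p, hp⟩

end CoordBound

theorem coordBound_tableMatrix {m : ℝ} (hk : ∀ i, 0 < k i) (hm1 : 1 ≤ m * Fintype.card (Cell k))
    (hm : ∀ i, (k i : ℝ) ≤ m * Fintype.card (Cell k)) :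
    CoordBound (tableMatrix k) ((2 * ν + 1) ^ 2 * m) where
  nonneg := by
    have hm0 : 0 ≤ m := (pos_of_mul_pos_left (zero_lt_one.trans_le hm1) (Nat.cast_nonneg _)).le
    positivity
  sq_le f t c := by
    set S := m * ∑ p, f (linForm (tableMatrix k) t p) ^ 2 with hS
    obtain ⟨p, hp⟩ := exists_sq_linForm_tableMatrix_le hk f t hm1
    have hS0 : 0 ≤ S := (sq_nonneg _).trans hp
    have hsection (i : Fin ν) (j : Fin (k i)) : f (sectionCoord k t i j) ≤ 2 * √S := by
      refine abs_le_of_sq_le_sq' ?_ (by positivity) |>.2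
      rw [mul_pow, Real.sq_sqrt hS0]
      linarith [sectionCoord_sq_le hk f t hm i j]
    suffices f (t c) ≤ (2 * ν + 1) * √S by
      calc f (t c) ^ 2 ≤ ((2 * ν + 1) * √S) ^ 2 := by gcongr
        _ = _ := by rw [mul_pow, Real.sq_sqrt hS0, hS, mul_assoc]
    rcases c with _ | ⟨i, j⟩
    · have hnone : t none = linForm (tableMatrix k) t p - ∑ i, sectionCoord k t i (p i) := by
        rw [linForm_tableMatrix, add_sub_cancel_right]
      have hsum : f (∑ i, sectionCoord k t i (p i)) ≤ ν * (2 * √S) :=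
        calc f (∑ i, sectionCoord k t i (p i)) ≤ ∑ i, f (sectionCoord k t i (p i)) :=
              Finset.le_sum_of_subadditive f (map_zero f).le (map_add_le_add f) _ _
          _ ≤ ∑ _i : Fin ν, 2 * √S := Finset.sum_le_sum fun i _ => hsection i (p i)
          _ = ν * (2 * √S) := by simp
      rw [hnone]
      linarith [map_sub_le_add f (linForm (tableMatrix k) t p) (∑ i, sectionCoord k t i (p i)),
        Real.le_sqrt_of_sq_le hp]
    · have hij := hsection i ⟨j, j.2.trans_le (Nat.sub_le _ _)⟩
      have hν : (1 : ℝ) ≤ ν := by exact_mod_cast i.pos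
      simp only [sectionCoord, j.2, dite_true] at hij
      exact hij.trans (by gcongr; linarith)

end Table

/-! ### Tables with large sides of the same order of magnitude -/

section Asymptotics

open Filter Topology

lemma tendsto_exp_neg_mul_pow_succ_mul_exp {α : ℝ} (hα : 0 < α) (a : ℝ) {n : ℕ} (hn : n ≠ 0) :
    Tendsto (fun y : ℝ => Real.exp (-(α * y ^ (n + 1))) * Real.exp (a * y ^ n)) atTop (𝓝 0) := by
  simp_rw [← Real.exp_add]
  refine Real.tendsto_exp_atBot.comp ?_
  have hgap : Tendsto (fun y : ℝ => y ^ n * (α * y - a)) atTop atTop :=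
    (tendsto_pow_atTop hn).atTop_mul_atTop₀
      (tendsto_atTop_add_const_right _ _ (tendsto_id.const_mul_atTop hα))
  refine (tendsto_neg_atTop_atBot.comp hgap).congr fun y => ?_
  simp only [Function.comp_apply]
  ring

variable {ν : ℕ} {k : Fin ν → ℕ}

lemma card_cell_cast (k : Fin ν → ℕ) : (Fintype.card (Cell k) : ℝ) = ∏ i, (k i : ℝ) := by
  simp [Cell, Fintype.card_pi]

lemma card_constraint_cast (hk : ∀ i, 0 < k i) :
    (Fintype.card (Constraint k) : ℝ) = 1 + ∑ i, ((k i : ℝ) - 1) := by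
  simp only [Constraint, Fintype.card_option, Fintype.card_sigma, Fintype.card_fin]
  push_cast [Nat.cast_sub (hk _)]
  ring

lemma card_constraint_le {C Y : ℝ} (hY : 1 ≤ Y) (hk : ∀ i, 0 < k i)
    (hkC : ∀ i, (k i : ℝ) ≤ C * Y) : (Fintype.card (Constraint k) : ℝ) ≤ (1 + ν * C) * Y := by
  rw [card_constraint_cast hk]
  calc 1 + ∑ i, ((k i : ℝ) - 1) ≤ Y + ∑ _i : Fin ν, C * Y := by
        gcongr with i
        linarith [hkC i]
    _ = (1 + ν * C) * Y := by
        simp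
        ring

/-- The rate at which the logarithm of the Gaussian normalization of a table may grow. -/
noncomputable def gaussianNormRate (ν : ℕ) (C W : ℝ) : ℝ :=
  (1 + ν * C) * (8 * (1 + ν * C) * (C ^ ν * W) + (8 * ν + 8))

lemma gaussianNorm_tableMatrix_le {w : Cell k → ℝ} {W C y : ℝ} (hy : 1 ≤ y) (hC : 0 ≤ C)
    (hW : 0 ≤ W) (hk : ∀ i, 0 < k i) (hkC : ∀ i, (k i : ℝ) ≤ C * y ^ 8)
    (hw0 : ∀ p, 0 ≤ w p) (hw : ∀ p, w p ≤ W) :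
    gaussianNorm (tableMatrix k) w ≤ Real.exp (gaussianNormRate ν C W * y ^ 9) := by
  set d := Fintype.card (Constraint k)
  set X := 8 * (1 + ν * C) * (C ^ ν * W) with hX
  have hX0 : 0 ≤ X := by positivity
  have hdle : (d : ℝ) ≤ (1 + ν * C) * y ^ 8 := card_constraint_le (one_le_pow₀ hy) hk hkC
  have hKle : (Fintype.card (Cell k) : ℝ) ≤ (C * y ^ 8) ^ ν := by
    rw [card_cell_cast]
    exact (Finset.prod_le_prod (fun i _ => by positivity) fun i _ => hkC i).trans_eq (by simp)
  have hbase : 2 * Real.pi * (d * (Fintype.card (Cell k) * W)) ≤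
      Real.exp ((X + (8 * ν + 8)) * y) :=
    calc 2 * Real.pi * (d * (Fintype.card (Cell k) * W))
        ≤ 2 * 4 * ((1 + ν * C) * y ^ 8 * ((C * y ^ 8) ^ ν * W)) := by
          gcongr
          exact Real.pi_le_four
      _ = X * y ^ (8 * ν + 8) := by rw [hX]; ring
      _ ≤ Real.exp X * Real.exp y ^ (8 * ν + 8) := by
          gcongr
          · linarith [Real.add_one_le_exp X]
          · linarith [Real.add_one_le_exp y]
      _ = Real.exp (X + (8 * ν + 8) * y) := by
          rw [← Real.exp_nat_mul, ← Real.exp_add]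
          push_cast
          ring_nf
      _ ≤ _ := by
          rw [Real.exp_le_exp]
          nlinarith
  refine le_of_abs_le (abs_le_of_sq_le_sq ?_ (Real.exp_nonneg _))
  calc gaussianNorm (tableMatrix k) w ^ 2
      ≤ (2 * Real.pi * (d * (Fintype.card (Cell k) * W))) ^ d :=
        gaussianNorm_sq_le abs_tableMatrix_le_one hw0 hw hW
    _ ≤ Real.exp ((X + (8 * ν + 8)) * y) ^ d := by gcongr
    _ = Real.exp (d * ((X + (8 * ν + 8)) * y)) := (Real.exp_nat_mul _ _).symm
    _ ≤ Real.exp ((1 + ν * C) * y ^ 8 * ((X + (8 * ν + 8)) * y)) := by gcongr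
    _ = Real.exp (gaussianNormRate ν C W * y ^ 9) := by rw [gaussianNormRate, ← hX]; ring_nf
    _ ≤ Real.exp (gaussianNormRate ν C W * y ^ 9) ^ 2 :=
        le_self_pow₀ (Real.one_le_exp (by unfold gaussianNormRate; positivity)) two_ne_zero

lemma sqrt_two_pow_card_constraint_le {C y : ℝ} (hy : 1 ≤ y) (hC : 0 ≤ C) (hk : ∀ i, 0 < k i)
    (hkC : ∀ i, (k i : ℝ) ≤ C * y ^ 8) :
    √2 ^ Fintype.card (Constraint k) ≤ Real.exp ((1 + ν * C) * y ^ 9) := by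
  have hsqrt : √2 ≤ Real.exp 1 :=
    (Real.sqrt_le_iff.mpr ⟨by norm_num, by norm_num⟩ : √2 ≤ 2).trans
      (by linarith [Real.add_one_le_exp 1])
  calc √2 ^ Fintype.card (Constraint k) ≤ Real.exp 1 ^ Fintype.card (Constraint k) := by gcongr
    _ = Real.exp (Fintype.card (Constraint k)) := by rw [← Real.exp_nat_mul, mul_one]
    _ ≤ Real.exp ((1 + ν * C) * y ^ 8) :=
        Real.exp_le_exp.mpr (card_constraint_le (one_le_pow₀ hy) hk hkC)
    _ ≤ Real.exp ((1 + ν * C) * y ^ 9) := by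
        gcongr
        norm_num

/-- The error of the local limit theorem for tables with sides between `c y ^ 8` and `C y ^ 8`,
as obtained by cutting off the Fourier integral at `formBall A (y ^ 10)`. -/
noncomputable def tableError (ν : ℕ) (c C W w₀ κ L y : ℝ) : ℝ :=
  (Real.exp (L * ((ν + 1) * ((2 * ν + 1) * √(C / c ^ ν))) / y) - 1)
    + Real.exp (-(w₀ / 4 * y ^ 10)) * Real.exp ((1 + ν * C) * y ^ 9)
    + Real.exp (-(2 * κ / Real.pi ^ 2 * y ^ 10)) * Real.exp (gaussianNormRate ν C W * y ^ 9)

lemma tendsto_tableError (ν : ℕ) (c C W : ℝ) {w₀ κ : ℝ} (hw₀ : 0 < w₀) (hκ : 0 < κ) (L : ℝ) :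
    Tendsto (tableError ν c C W w₀ κ L) atTop (𝓝 0) := by
  have hcentral : Tendsto (fun y : ℝ =>
      Real.exp (L * ((ν + 1) * ((2 * ν + 1) * √(C / c ^ ν))) / y) - 1) atTop (𝓝 0) := by
    have h := (Real.continuous_exp.tendsto 0).comp
      ((tendsto_const_nhds (x := L * ((ν + 1) * ((2 * ν + 1) * √(C / c ^ ν))))).div_atTop
        tendsto_id)
    simpa using h.sub_const 1
  have htail := tendsto_exp_neg_mul_pow_succ_mul_exp (α := w₀ / 4) (by positivity) (1 + ν * C)
    (n := 9) (by norm_num)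
  have hfar := tendsto_exp_neg_mul_pow_succ_mul_exp (α := 2 * κ / Real.pi ^ 2) (by positivity)
    (gaussianNormRate ν C W) (n := 9) (by norm_num)
  have hsum := (hcentral.add htail).add hfar
  rw [add_zero, add_zero] at hsum
  exact hsum

lemma le_mul_card_cell (hν : 5 ≤ ν) {c C y : ℝ} (hc : 0 < c) (hC : 0 ≤ C) (hy : 1 ≤ y)
    (hkc : ∀ i, c * y ^ 8 ≤ k i) (hkC : ∀ i, (k i : ℝ) ≤ C * y ^ 8) (i : Fin ν) :
    (k i : ℝ) ≤ C / c ^ ν / y ^ 32 * Fintype.card (Cell k) := by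
  have hKge : (c * y ^ 8) ^ ν ≤ (Fintype.card (Cell k) : ℝ) := by
    rw [card_cell_cast]
    exact (by simp : (c * y ^ 8) ^ ν = ∏ _i : Fin ν, c * y ^ 8).trans_le
      (Finset.prod_le_prod (fun i _ => by positivity) fun i _ => hkc i)
  calc (k i : ℝ) ≤ C * y ^ 8 := hkC i
    _ ≤ C * y ^ (8 * ν - 32) := by
        gcongr
        omega
    _ = C / c ^ ν / y ^ 32 * (c * y ^ 8) ^ ν := by
        rw [mul_pow, ← pow_mul, show 8 * ν = (8 * ν - 32) + 32 by omega, pow_add,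
          Nat.add_sub_cancel]
        field_simp
    _ ≤ _ := by gcongr

variable {μ : Cell k → Measure ℕ} [∀ p, IsProbabilityMeasure (μ p)] {z w : Cell k → ℝ} {κ L : ℝ}

lemma abs_measureReal_table_mul_gaussianNorm_sub_one_le (hν : 5 ≤ ν) {c C W w₀ y : ℝ}
    (hc : 0 < c) (hC : 0 ≤ C) (hW : 0 ≤ W) (hw₀ : 0 < w₀) (hκ : 0 ≤ κ) (hL : 0 ≤ L) (hy : 1 ≤ y)
    (hyν : (ν + 1) * ((2 * ν + 1) * √(C / c ^ ν)) ≤ y ^ 11) (hk : ∀ i, 0 < k i)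
    (hkc : ∀ i, c * y ^ 8 ≤ k i) (hkC : ∀ i, (k i : ℝ) ≤ C * y ^ 8) (hw : ∀ p, w₀ ≤ w p)
    (hwW : ∀ p, w p ≤ W) (hμ : ∀ p, IsNearGaussian (μ p) (z p) (w p) κ L) {b : Constraint k → ℤ}
    (hb : (tableMatrix k).map (Int.cast : ℤ → ℝ) *ᵥ z = fun c => (b c : ℝ)) :
    |(Measure.pi μ).real {x | tableMatrix k *ᵥ (fun p => (x p : ℤ)) = b} *
      gaussianNorm (tableMatrix k) w - 1| ≤ tableError ν c C W w₀ κ L y := by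
  have : 0 < y := zero_lt_one.trans_le hy
  have hm := le_mul_card_cell hν hc hC hy hkc hkC
  have hm1 : 1 ≤ C / c ^ ν / y ^ 32 * Fintype.card (Cell k) :=
    le_trans (by exact_mod_cast hk ⟨0, by omega⟩) (hm ⟨0, by omega⟩)
  have hsqrt : √((2 * ν + 1) ^ 2 * (C / c ^ ν / y ^ 32) * y ^ 10) =
      (2 * ν + 1) * √(C / c ^ ν) / y ^ 11 := by
    rw [show (2 * ν + 1 : ℝ) ^ 2 * (C / c ^ ν / y ^ 32) * y ^ 10 =
        (2 * ν + 1) ^ 2 * (C / c ^ ν) / (y ^ 11) ^ 2 by field_simp,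
      Real.sqrt_div (by positivity), Real.sqrt_sq (by positivity),
      Real.sqrt_mul (by positivity), Real.sqrt_sq (by positivity)]
  have hlocal := abs_measureReal_linear_system_mul_gaussianNorm_sub_one_le hμ hb (s := y ^ 10) hκ
    hL (coordBound_tableMatrix hk hm1 hm) sum_abs_tableMatrix_le (by simp) (by positivity)
    (by rwa [hsqrt, ← mul_div_assoc, div_le_one (by positivity)]) hw₀ hw
  refine hlocal.trans ?_
  rw [hsqrt, tableError]
  gcongr ?_ - 1 + _ * ?_ + _ * ?_
  · refine (congrArg Real.exp ?_).le
    field_simp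
  · exact sqrt_two_pow_card_constraint_le hy hC hk hkC
  · exact gaussianNorm_tableMatrix_le hy hC hW hk hkC (fun p => hw₀.le.trans (hw p)) hwW

theorem eventually_abs_measureReal_table_mul_gaussianNorm_sub_one_le (hν : 5 ≤ ν)
    {c w₀ κ L ε : ℝ} (C W : ℝ) (hc : 0 < c) (hw₀ : 0 < w₀) (hκ : 0 < κ) (hL : 0 ≤ L)
    (hε : 0 < ε) :
    ∀ᶠ n : ℕ in atTop, ∀ k : Fin ν → ℕ, (∀ i, 0 < k i) →
      (∀ i, c * n ≤ k i ∧ (k i : ℝ) ≤ C * n) →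
      ∀ (μ : Cell k → Measure ℕ) (_ : ∀ p, IsProbabilityMeasure (μ p)) (z w : Cell k → ℝ),
      (∀ p, w₀ ≤ w p ∧ w p ≤ W) → (∀ p, IsNearGaussian (μ p) (z p) (w p) κ L) →
      ∀ b : Constraint k → ℤ,
      (tableMatrix k).map (Int.cast : ℤ → ℝ) *ᵥ z = (fun c => (b c : ℝ)) →
      |(Measure.pi μ).real {x | tableMatrix k *ᵥ (fun p => (x p : ℤ)) = b} *
        gaussianNorm (tableMatrix k) w - 1| ≤ ε := by
  have hroot : Tendsto (fun n : ℕ => (n : ℝ) ^ (1 / 8 : ℝ)) atTop atTop :=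
    (tendsto_rpow_atTop (by norm_num)).comp tendsto_natCast_atTop_atTop
  have herror := (tendsto_tableError ν c (max C 0) (max W 0) hw₀ hκ L).eventually_le_const hε
  have hlarge := (tendsto_pow_atTop (α := ℝ) (n := 11) (by norm_num)).eventually_ge_atTop
    ((ν + 1) * ((2 * ν + 1) * √(max C 0 / c ^ ν)))
  filter_upwards [hroot.eventually (herror.and (hlarge.and (eventually_ge_atTop 1)))]
    with n ⟨hny, hnν, hn1⟩ k hk hkn μ _ z w hw hμ b hb
  have hy : ((n : ℝ) ^ (1 / 8 : ℝ)) ^ 8 = n := by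
    rw [← Real.rpow_natCast, ← Real.rpow_mul (by positivity)]
    norm_num
  refine (abs_measureReal_table_mul_gaussianNorm_sub_one_le hν hc (le_max_right _ _)
    (le_max_right _ _) hw₀ hκ.le hL hn1 hnν hk (fun i => ?_) (fun i => ?_) (fun p => (hw p).1)
    (fun p => (hw p).2.trans (le_max_left _ _)) hμ hb).trans hny
  · rw [hy]
    exact (hkn i).1
  · rw [hy]
    exact (hkn i).2.trans (mul_le_mul_of_nonneg_right (le_max_left _ _) (Nat.cast_nonneg n))

end Asymptotics

/-! ### Lattice and determinant of the table equations -/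

section Lattice

variable {ν : ℕ} {k : Fin ν → ℕ}

/-- The cell that lies in the last section of every direction, so that its column of `tableMatrix`
is the basis vector of the total sum. -/
def lastCell (hk : ∀ i, 0 < k i) : Cell k := fun i => ⟨k i - 1, Nat.sub_one_lt (hk i).ne'⟩

lemma tableMatrix_some (i : Fin ν) (j : Fin (k i - 1)) (p : Cell k) :
    tableMatrix k (some ⟨i, j⟩) p = if p i = Fin.castLE (Nat.sub_le _ _) j then 1 else 0 := by
  simp [tableMatrix, Fin.ext_iff]

lemma tableMatrix_lastCell (hk : ∀ i, 0 < k i) :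
    (tableMatrix k).col (lastCell hk) = Pi.single none 1 := by
  funext c
  rcases c with _ | ⟨i, j⟩
  · simp [tableMatrix]
  · have hj : k i - 1 ≠ (j : ℕ) := j.2.ne'
    simp [tableMatrix, lastCell, hj]

lemma tableMatrix_update_lastCell (hk : ∀ i, 0 < k i) (i : Fin ν) (j : Fin (k i - 1)) :
    (tableMatrix k).col (Function.update (lastCell hk) i (Fin.castLE (Nat.sub_le _ _) j)) =
      (tableMatrix k).col (lastCell hk) + Pi.single (some ⟨i, j⟩) 1 := by
  rw [tableMatrix_lastCell]
  funext c
  rcases c with _ | ⟨i', j'⟩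
  · simp [tableMatrix]
  · have hj' : k i' - 1 ≠ (j' : ℕ) := j'.2.ne'
    rcases eq_or_ne i' i with rfl | hi
    · simp [tableMatrix, Pi.single_apply, Fin.ext_iff, eq_comm]
    · simp [tableMatrix, lastCell, hi, hj']

lemma imageLattice_tableMatrix (hk : ∀ i, 0 < k i) :
    imageLattice (tableMatrix k) =
      Submodule.span ℤ (Set.range (Pi.basisFun ℝ (Constraint k))) := by
  refine le_antisymm (Submodule.span_le.mpr ?_) (Submodule.span_le.mpr ?_)
  · rintro _ ⟨y, rfl⟩
    rw [SetLike.mem_coe, Module.Basis.mem_span_iff_repr_mem]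
    exact fun c => ⟨(tableMatrix k *ᵥ y) c, by simp⟩
  · suffices ∀ c, ∃ y, tableMatrix k *ᵥ y = Pi.single c 1 by
      rintro _ ⟨c, rfl⟩
      obtain ⟨y, hy⟩ := this c
      refine Submodule.subset_span ⟨y, ?_⟩
      funext c'
      simp [hy, Pi.single_apply]
    rintro (_ | ⟨i, j⟩)
    · exact ⟨Pi.single (lastCell hk) 1, by rw [mulVec_single_one, tableMatrix_lastCell]⟩
    · refine ⟨Pi.single (Function.update (lastCell hk) i (Fin.castLE (Nat.sub_le _ _) j)) 1
        - Pi.single (lastCell hk) 1, ?_⟩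
      rw [mulVec_sub, mulVec_single_one, mulVec_single_one, tableMatrix_update_lastCell,
        add_sub_cancel_left]

lemma covolume_imageLattice_tableMatrix (hk : ∀ i, 0 < k i) :
    ZLattice.covolume (imageLattice (tableMatrix k)) = 1 := by
  rw [imageLattice_tableMatrix hk,
    ZLattice.covolume_eq_measure_fundamentalDomain _ _
      (ZSpan.isAddFundamentalDomain (Pi.basisFun ℝ (Constraint k)) volume),
    ZSpan.fundamentalDomain_pi_basisFun, measureReal_def, volume_pi_pi]
  simp

end Lattice

section BlockDeterminant

/-- The Schur complement of the entry at `none`, meaningful only if that entry is nonzero. -/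
def schurNone {n R : Type*} [Field R] (M : Matrix (Option n) (Option n) R) : Matrix n n R :=
  of fun a b => M (some a) (some b) - M (some a) none * M none (some b) / M none none

lemma det_eq_mul_det_schurNone {n R : Type*} [Fintype n] [DecidableEq n] [Field R]
    (M : Matrix (Option n) (Option n) R) (hM : M none none ≠ 0) :
    M.det = M none none * (schurNone M).det := by
  let e : n ⊕ Unit ≃ Option n := (Equiv.optionEquivSumPUnit n).symm
  let D : Matrix Unit Unit R := of fun _ _ => M none none
  let _ : Invertible D := invertibleOfRightInverse D (of fun _ _ => (M none none)⁻¹) <| by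
    ext
    simp [D, mul_apply, hM]
  have hblocks : M.submatrix e e = fromBlocks (of fun a b => M (some a) (some b))
      (of fun a _ => M (some a) none) (of fun _ b => M none (some b)) D := by
    ext (a | _) (b | _) <;> simp [e, D]
  have hinv : ⅟D = of fun _ _ => (M none none)⁻¹ := rfl
  rw [← det_submatrix_equiv_self e, hblocks, det_fromBlocks₂₂, hinv]
  congr 2
  · simp [D]
  · ext a b
    simp [schurNone, mul_apply, div_eq_mul_inv, mul_right_comm]

lemma det_blockDiagonal' {ι R : Type*} {n : ι → Type*} [Fintype ι] [LinearOrder ι]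
    [∀ i, Fintype (n i)] [∀ i, DecidableEq (n i)] [CommRing R] (M : ∀ i, Matrix (n i) (n i) R) :
    (blockDiagonal' M).det = ∏ i, (M i).det := by
  rw [(blockTriangular_blockDiagonal' M).det_fintype]
  refine Finset.prod_congr rfl fun i _ => ?_
  rw [← det_submatrix_equiv_self (Equiv.sigmaSubtype i).symm]
  congr 1
  ext a b
  exact blockDiagonal'_apply_eq M i a b

lemma det_smul_one_sub_const {n R : Type*} [Fintype n] [DecidableEq n] [CommRing R] (a c : R) :
    det (a • (1 - of fun _ _ : n => c)) = a ^ Fintype.card n * (1 - Fintype.card n * c) := by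
  have hrank : (1 - of fun _ _ : n => c) = 1 + replicateCol Unit (fun _ : n => -c) *
      replicateRow Unit (fun _ : n => (1 : R)) := by
    ext i j
    simp [mul_apply, sub_eq_add_neg]
  rw [det_smul, hrank, det_one_add_replicateCol_mul_replicateRow]
  simp [dotProduct, sub_eq_add_neg]

end BlockDeterminant

section Determinant

variable {ν : ℕ} {k : Fin ν → ℕ}

lemma card_filter_forall_mem_eq (s : Finset (Fin ν)) (x : Cell k) :
    (Finset.univ.filter fun p : Cell k => ∀ i ∈ s, p i = x i).card * ∏ i ∈ s, k i =
      Fintype.card (Cell k) := by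
  have hpi : (Finset.univ.filter fun p : Cell k => ∀ i ∈ s, p i = x i) =
      Fintype.piFinset fun i => if i ∈ s then {x i} else Finset.univ := by
    ext p
    simp only [Finset.mem_filter, Finset.mem_univ, true_and, Fintype.mem_piFinset]
    refine forall_congr' fun i => ?_
    split_ifs with h <;> simp [h]
  have hcompl : (Finset.univ.filter fun p : Cell k => ∀ i ∈ s, p i = x i).card =
      ∏ i ∈ sᶜ, k i := by
    rw [hpi, Fintype.card_piFinset, ← Finset.prod_compl_mul_prod s]
    have hin : ∏ i ∈ s, (if i ∈ s then {x i} else Finset.univ : Finset (Fin (k i))).card = 1 :=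
      Finset.prod_eq_one fun i hi => by simp [hi]
    rw [hin, mul_one]
    exact Finset.prod_congr rfl fun i hi => by simp [Finset.mem_compl.mp hi]
  rw [hcompl, Finset.prod_compl_mul_prod]
  simp

lemma sum_tableMatrix_some (hk : ∀ i, 0 < k i) (i : Fin ν) (j : Fin (k i - 1)) :
    (∑ p, tableMatrix k (some ⟨i, j⟩) p : ℤ) * k i = Fintype.card (Cell k) := by
  have h := card_filter_forall_mem_eq {i}
    (Function.update (lastCell hk) i (Fin.castLE (Nat.sub_le _ _) j))
  simp only [Finset.mem_singleton, forall_eq, Function.update_self, Finset.prod_singleton] at h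
  simp only [tableMatrix_some, Finset.sum_boole]
  exact_mod_cast h

lemma sum_tableMatrix_some_mul_of_ne (hk : ∀ i, 0 < k i) {i i' : Fin ν} (hi : i ≠ i')
    (j : Fin (k i - 1)) (j' : Fin (k i' - 1)) :
    (∑ p, tableMatrix k (some ⟨i, j⟩) p * tableMatrix k (some ⟨i', j'⟩) p : ℤ) *
      (k i * k i') = Fintype.card (Cell k) := by
  have h := card_filter_forall_mem_eq {i, i'} (Function.update
    (Function.update (lastCell hk) i' (Fin.castLE (Nat.sub_le _ _) j')) i
    (Fin.castLE (Nat.sub_le _ _) j))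
  simp only [Finset.mem_insert, Finset.mem_singleton, forall_eq_or_imp, forall_eq,
    Function.update_self, Function.update_of_ne hi.symm, Finset.prod_pair hi] at h
  simp only [tableMatrix_some, ite_zero_mul_ite_zero, mul_one, Finset.sum_boole]
  exact_mod_cast h

lemma tableMatrix_some_mul_of_eq {i : Fin ν} (j j' : Fin (k i - 1)) (p : Cell k) :
    tableMatrix k (some ⟨i, j⟩) p * tableMatrix k (some ⟨i, j'⟩) p =
      if j = j' then tableMatrix k (some ⟨i, j⟩) p else 0 := by
  rcases eq_or_ne j j' with rfl | hj
  · simp [tableMatrix]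
  · simp only [tableMatrix, of_apply, ite_zero_mul_ite_zero, hj, if_false]
    exact if_neg fun h => hj (Fin.ext (h.1.symm.trans h.2))

lemma schurNone_tableMatrix_mul_transpose (hk : ∀ i, 0 < k i) :
    schurNone ((tableMatrix k * (tableMatrix k)ᵀ).map (Int.cast : ℤ → ℚ)) =
      blockDiagonal' fun i => (Fintype.card (Cell k) / k i : ℚ) •
        (1 - of fun _ _ : Fin (k i - 1) => (1 / k i : ℚ)) := by
  have hk0 (i : Fin ν) : (k i : ℚ) ≠ 0 := Nat.cast_ne_zero.mpr (hk i).ne'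
  have hK : (Fintype.card (Cell k) : ℚ) ≠ 0 :=
    Nat.cast_ne_zero.mpr (Fintype.card_pos_iff.mpr ⟨lastCell hk⟩).ne'
  have hone (i : Fin ν) (j : Fin (k i - 1)) :
      ((∑ p, tableMatrix k (some ⟨i, j⟩) p : ℤ) : ℚ) = Fintype.card (Cell k) / k i := by
    rw [eq_div_iff (hk0 i)]
    exact_mod_cast sum_tableMatrix_some hk i j
  have hnone (p : Cell k) : tableMatrix k none p = 1 := rfl
  ext ⟨i, j⟩ ⟨i', j'⟩
  simp only [schurNone, map_apply, of_apply, mul_apply, transpose_apply, hnone, mul_one, one_mul,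
    hone, Finset.sum_const, Finset.card_univ, nsmul_one, Int.cast_natCast]
  rcases eq_or_ne i i' with rfl | hi
  · rw [blockDiagonal'_apply_eq]
    simp only [tableMatrix_some_mul_of_eq, Matrix.smul_apply, Matrix.sub_apply, of_apply,
      one_apply, smul_eq_mul]
    split_ifs
    · rw [hone]
      field_simp [hk0 i]
    · rw [Finset.sum_const_zero, Int.cast_zero]
      field_simp
      ring
  · have htwo : ((∑ p, tableMatrix k (some ⟨i, j⟩) p * tableMatrix k (some ⟨i', j'⟩) p : ℤ) : ℚ) =
        Fintype.card (Cell k) / (k i * k i') := by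
      rw [eq_div_iff (mul_ne_zero (hk0 i) (hk0 i'))]
      exact_mod_cast sum_tableMatrix_some_mul_of_ne hk hi j j'
    rw [blockDiagonal'_apply_ne _ _ _ hi, htwo]
    field_simp
    ring

theorem det_tableMatrix_mul_transpose (hk : ∀ i, 0 < k i) :
    (tableMatrix k * (tableMatrix k)ᵀ).det =
      ∏ i, (∏ j ∈ Finset.univ.erase i, (k j : ℤ)) ^ (k i - 1) := by
  have hk0 (i : Fin ν) : (k i : ℚ) ≠ 0 := Nat.cast_ne_zero.mpr (hk i).ne'
  have hcard : (Fintype.card (Cell k) : ℚ) = ∏ i, (k i : ℚ) := by simp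
  have hdiv (i : Fin ν) :
      (∏ j, (k j : ℚ)) / k i = ∏ j ∈ Finset.univ.erase i, (k j : ℚ) := by
    rw [← Finset.prod_erase_mul _ _ (Finset.mem_univ i), mul_div_cancel_right₀ _ (hk0 i)]
  have hblock (i : Fin ν) : (1 : ℚ) - (k i - 1 : ℕ) * (1 / k i) = (k i : ℚ)⁻¹ := by
    rw [Nat.cast_pred (hk i)]
    field_simp [hk0 i]
    ring
  have htotal : (tableMatrix k * (tableMatrix k)ᵀ) none none = Fintype.card (Cell k) := by
    simp [mul_apply, tableMatrix]
  have hdet := det_eq_mul_det_schurNone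
      ((tableMatrix k * (tableMatrix k)ᵀ).map (Int.cast : ℤ → ℚ)) <| by
    rw [map_apply, htotal]
    simp [hk0, Finset.prod_ne_zero_iff]
  simp only [map_apply, schurNone_tableMatrix_mul_transpose hk, det_blockDiagonal',
    det_smul_one_sub_const, Fintype.card_fin, hblock, Finset.prod_mul_distrib, htotal] at hdet
  rw [← Int.cast_det] at hdet
  have hprod : (∏ i, (k i : ℚ)) ≠ 0 := Finset.prod_ne_zero_iff.mpr fun i _ => hk0 i
  simp only [Int.cast_natCast, hcard, hdiv, Finset.prod_inv_distrib] at hdet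
  rw [mul_left_comm, mul_inv_cancel₀ hprod, mul_one] at hdet
  exact_mod_cast hdet

theorem det_tableMatrix_mul_transpose_const {n : ℕ} (hn : 0 < n) :
    (tableMatrix (fun _ : Fin ν => n) * (tableMatrix (fun _ : Fin ν => n))ᵀ).det =
      (n : ℤ) ^ ((ν ^ 2 - ν) * (n - 1)) := by
  rw [det_tableMatrix_mul_transpose fun _ => hn]
  simp only [Finset.prod_const, Finset.card_erase_of_mem (Finset.mem_univ _), Finset.card_univ,
    Fintype.card_fin, ← pow_mul]
  congr 1
  rw [sq, ← Nat.sub_one_mul]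
  ring

end Determinant

/-! ### Integer points and maximum entropy -/

section IntegerPoints

lemma natCast_comp_injective {J : Type*} : Function.Injective fun (x : J → ℕ) j => (x j : ℝ) :=
  fun _ _ h => funext fun j => Nat.cast_injective (congrFun h j)

variable {D J : Type} [Fintype J] {A : Matrix D J ℤ} {b : D → ℤ}

/-- The solutions of `A x = b` in natural numbers. -/
def natSolutions (A : Matrix D J ℤ) (b : D → ℤ) : Set (J → ℕ) :=
  {x | (A *ᵥ fun j => (x j : ℤ)) = b}

/-- The solutions of `A x = b` with entries `0` and `1`, inside the natural solutions. -/
def binarySolutions (A : Matrix D J ℤ) (b : D → ℤ) : Set (J → ℕ) :=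
  {x | x ∈ natSolutions A b ∧ ∀ j, x j = 0 ∨ x j = 1}

lemma natCast_mem_polytope_iff {x : J → ℕ} :
    (fun j => (x j : ℝ)) ∈ polytope A b ↔ x ∈ natSolutions A b := by
  simp only [polytope, natSolutions, Set.mem_ofPred_eq, Nat.cast_nonneg, implies_true, and_true,
    funext_iff, mulVec, dotProduct, map_apply]
  exact_mod_cast Iff.rfl

lemma numIntegerPoints_polytope :
    numIntegerPoints (polytope A b) = (natSolutions A b).ncard := by
  rw [numIntegerPoints, ← Set.ncard_image_of_injective _ natCast_comp_injective]
  congr 1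
  ext x
  constructor
  · rintro ⟨hx, hint⟩
    choose m hm using hint
    obtain rfl : x = fun j => (m j : ℝ) := funext hm
    have hm0 (j : J) : (0 : ℝ) ≤ m j := hx.2 j
    lift m to J → ℕ using fun j => by exact_mod_cast hm0 j
    simp only [Int.cast_natCast] at hx ⊢
    exact ⟨m, natCast_mem_polytope_iff.mp hx, rfl⟩
  · rintro ⟨y, hy, rfl⟩
    exact ⟨natCast_mem_polytope_iff.mpr hy, fun j => ⟨y j, by simp⟩⟩

lemma natCast_mem_polytope01_iff {x : J → ℕ} :
    (fun j => (x j : ℝ)) ∈ polytope01 A b ↔ x ∈ binarySolutions A b := by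
  simp only [polytope01, binarySolutions, Set.mem_ofPred_eq, natCast_mem_polytope_iff,
    Nat.cast_le_one, Nat.le_one_iff_eq_zero_or_eq_one]

lemma numBinaryPoints_polytope01 :
    numBinaryPoints (polytope01 A b) = (binarySolutions A b).ncard := by
  rw [numBinaryPoints, ← Set.ncard_image_of_injective _ natCast_comp_injective]
  congr 1
  ext x
  constructor
  · rintro ⟨hx, hbinary⟩
    have hnat (j : J) : ∃ n : ℕ, x j = n := by
      rcases hbinary j with h | h
      · exact ⟨0, by simp [h]⟩
      · exact ⟨1, by simp [h]⟩
    choose y hy using hnat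
    obtain rfl : x = fun j => (y j : ℝ) := funext hy
    exact ⟨y, natCast_mem_polytope01_iff.mp hx, rfl⟩
  · rintro ⟨y, hy, rfl⟩
    refine ⟨natCast_mem_polytope01_iff.mpr hy, fun j => ?_⟩
    simpa using hy.2 j

end IntegerPoints

section Stationary

lemma continuous_lineMap_apply {J : Type*} (x z : J → ℝ) (j : J) :
    Continuous fun τ : ℝ => (AffineMap.lineMap z x τ : J → ℝ) j :=
  (continuous_apply j).comp AffineMap.lineMap_continuous

variable {J : Type} [Fintype J]

/-- First-order optimality at `z`, over the set `P`, of a function with gradient `v` at `z`, for a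
set `P` in which every segment from `z` can be prolonged beyond `z`. -/
def IsStationaryOn (P : Set (J → ℝ)) (v z : J → ℝ) : Prop :=
  ∀ x ∈ P, ∑ j, (x j - z j) * v j = 0

lemma isStationaryOn_of_isMaxOn {P : Set (J → ℝ)} {φ : ℝ → ℝ} {v z : J → ℝ}
    (hφ : ∀ j, HasDerivAt φ (v j) (z j))
    (hP : ∀ x ∈ P, ∀ᶠ τ in nhds (0 : ℝ), AffineMap.lineMap z x τ ∈ P)
    (hmax : IsMaxOn (fun x => ∑ j, φ (x j)) P z) : IsStationaryOn P v z := by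
  intro x hx
  have hlocal : IsLocalMax (fun τ : ℝ => ∑ j, φ (AffineMap.lineMap (z j) (x j) τ)) 0 := by
    filter_upwards [hP x hx] with τ hτ
    simpa [AffineMap.lineMap_apply] using hmax hτ
  refine hlocal.hasDerivAt_eq_zero (HasDerivAt.fun_sum fun j _ => ?_)
  have hline : HasDerivAt (AffineMap.lineMap (z j) (x j)) (x j - z j) (0 : ℝ) :=
    AffineMap.hasDerivAt_lineMap
  have hφj : HasDerivAt φ (v j) (AffineMap.lineMap (z j) (x j) (0 : ℝ)) := by simpa using hφ j
  exact (hφj.comp (0 : ℝ) hline).congr_deriv (mul_comm _ _)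

variable {D : Type} {A : Matrix D J ℤ} {b : D → ℤ} {x z : J → ℝ}

lemma eventually_lineMap_mem_polytope (hx : x ∈ polytope A b) (hz : z ∈ polytope A b)
    (hz0 : ∀ j, 0 < z j) : ∀ᶠ τ in nhds (0 : ℝ), AffineMap.lineMap z x τ ∈ polytope A b := by
  have hpos : ∀ᶠ τ in nhds (0 : ℝ), ∀ j, 0 < (AffineMap.lineMap z x τ : J → ℝ) j :=
    Filter.eventually_all.mpr fun j =>
      (continuous_lineMap_apply x z j).continuousAt.eventually (lt_mem_nhds (by simpa using hz0 j))
  filter_upwards [hpos] with τ hτ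
  refine ⟨?_, fun j => (hτ j).le⟩
  rw [AffineMap.lineMap_apply_module, mulVec_add, mulVec_smul, mulVec_smul, hx.1, hz.1,
    ← add_smul, sub_add_cancel, one_smul]

lemma eventually_lineMap_mem_polytope01 (hx : x ∈ polytope01 A b) (hz : z ∈ polytope01 A b)
    (hz0 : ∀ j, 0 < z j) (hz1 : ∀ j, z j < 1) :
    ∀ᶠ τ in nhds (0 : ℝ), AffineMap.lineMap z x τ ∈ polytope01 A b := by
  have hlt : ∀ᶠ τ in nhds (0 : ℝ), ∀ j, (AffineMap.lineMap z x τ : J → ℝ) j < 1 :=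
    Filter.eventually_all.mpr fun j =>
      (continuous_lineMap_apply x z j).continuousAt.eventually (gt_mem_nhds (by simpa using hz1 j))
  filter_upwards [eventually_lineMap_mem_polytope hx.1 hz.1 hz0, hlt] with τ hτ hτ1
  exact ⟨hτ, fun j => (hτ1 j).le⟩

lemma isStationaryOn_of_isMaxOn_geomEntropy (hz : z ∈ polytope A b) (hz0 : ∀ j, 0 < z j)
    (hmax : IsMaxOn geomEntropy (polytope A b) z) :
    IsStationaryOn (polytope A b) (fun j => Real.log ((1 + z j) / z j)) z := by
  refine isStationaryOn_of_isMaxOn (φ := fun y => (y + 1) * Real.log (y + 1) - y * Real.log y)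
    (fun j => ?_) (fun x hx => eventually_lineMap_mem_polytope hx hz hz0) hmax
  have hj := hz0 j
  have hsucc : z j + 1 ≠ 0 := by positivity
  refine (((Real.hasDerivAt_mul_log hsucc).comp_add_const (z j) 1).sub
    (Real.hasDerivAt_mul_log hj.ne')).congr_deriv ?_
  rw [Real.log_div (by positivity) hj.ne', add_comm 1]
  ring

lemma isStationaryOn_of_isMaxOn_bernoulliEntropy (hz : z ∈ polytope01 A b) (hz0 : ∀ j, 0 < z j)
    (hz1 : ∀ j, z j < 1) (hmax : IsMaxOn bernoulliEntropy (polytope01 A b) z) :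
    IsStationaryOn (polytope01 A b) (fun j => Real.log ((1 - z j) / z j)) z := by
  refine isStationaryOn_of_isMaxOn
    (φ := fun y => y * Real.log (1 / y) + (1 - y) * Real.log (1 / (1 - y)))
    (fun j => ?_) (fun x hx => eventually_lineMap_mem_polytope01 hx hz hz0 hz1) hmax
  have hj := (hz0 j).ne'
  have hcompl := (sub_pos.mpr (hz1 j)).ne'
  simp only [one_div, Real.log_inv, mul_neg]
  refine ((Real.hasDerivAt_mul_log hj).neg.add
    ((Real.hasDerivAt_mul_log hcompl).comp_const_sub 1 (z j)).neg).congr_deriv ?_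
  rw [Real.log_div hcompl hj]
  ring

end Stationary

section MaximumEntropy

lemma measureReal_eq_ncard_mul {α : Type*} [Countable α] [MeasurableSpace α]
    [MeasurableSingletonClass α] (μ : Measure α) [IsFiniteMeasure μ] {S : Set α} {e : ℝ}
    (hS : ∀ x ∈ S, μ.real {x} = e) : μ.real S = S.ncard * e := by
  have htsum : μ S = ∑' x : S, μ {(x : α)} := by
    simpa using (tsum_measure_preimage_singleton (μ := μ) (f := id) S.to_countable
      fun x _ => measurableSet_singleton x).symm
  calc μ.real S = ∑' x : S, μ.real {(x : α)} := by
        rw [measureReal_def, htsum, ENNReal.tsum_toReal_eq fun x => measure_ne_top μ _]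
        rfl
    _ = ∑' _x : S, e := tsum_congr fun x => hS x x.2
    _ = S.ncard * e := by rw [tsum_const, Nat.card_coe_set_eq, nsmul_eq_mul]

lemma measureReal_pi_eq_ncard_mul_exp {J : Type*} [Fintype J] (μ : J → Measure ℕ)
    [∀ j, IsProbabilityMeasure (μ j)] {S : Set (J → ℕ)} {H v z : J → ℝ}
    (hμ : ∀ x ∈ S, ∀ j, (μ j).real {x j} = Real.exp (-H j - (x j - z j) * v j))
    (hS : ∀ x ∈ S, ∑ j, ((x j : ℝ) - z j) * v j = 0) :
    (Measure.pi μ).real S = S.ncard * Real.exp (-∑ j, H j) := by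
  refine measureReal_eq_ncard_mul _ fun x hx => ?_
  calc (Measure.pi μ).real {x} = ∏ j, (μ j).real {x j} := by
        rw [measureReal_def, Measure.pi_singleton, ENNReal.toReal_prod]
        rfl
    _ = Real.exp (-∑ j, H j) := by
        rw [Finset.prod_congr rfl fun j _ => hμ x hx j, ← Real.exp_sum, Finset.sum_sub_distrib,
          hS x hx, Finset.sum_neg_distrib, sub_zero]

variable {D J : Type} [Fintype J] {A : Matrix D J ℤ} {b : D → ℤ} {z : J → ℝ}

theorem numIntegerPoints_eq_exp_geomEntropy_mul (hz0 : ∀ j, 0 < z j)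
    (hz : IsStationaryOn (polytope A b) (fun j => Real.log ((1 + z j) / z j)) z) :
    (numIntegerPoints (polytope A b) : ℝ) =
      Real.exp (geomEntropy z) *
        (Measure.pi fun j => geomDist (z j)).real (natSolutions A b) := by
  rw [measureReal_pi_eq_ncard_mul_exp _ (fun x _ j => geomDist_real_singleton (hz0 j) (x j))
    fun x hx => hz _ (natCast_mem_polytope_iff.mpr hx), ← numIntegerPoints_polytope, mul_left_comm,
    ← geomEntropy, ← Real.exp_add, add_neg_cancel, Real.exp_zero, mul_one]

theorem numBinaryPoints_eq_exp_bernoulliEntropy_mul (hz0 : ∀ j, 0 < z j) (hz1 : ∀ j, z j < 1)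
    (hz : IsStationaryOn (polytope01 A b) (fun j => Real.log ((1 - z j) / z j)) z) :
    (numBinaryPoints (polytope01 A b) : ℝ) =
      Real.exp (bernoulliEntropy z) *
        (Measure.pi fun j => bernDist (z j)).real (natSolutions A b) := by
  have hbinary : ∀ᵐ x ∂Measure.pi fun j => bernDist (z j), ∀ j, x j = 0 ∨ x j = 1 :=
    Filter.eventually_all.mpr fun j =>
      (Measure.tendsto_eval_ae_ae (μ := fun j => bernDist (z j)) (i := j)).eventually
        (ae_bernDist (z j))
  have hsupport : natSolutions A b =ᵐ[Measure.pi fun j => bernDist (z j)] binarySolutions A b := by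
    filter_upwards [hbinary] with x hx
    exact propext (and_iff_left hx).symm
  rw [measureReal_congr hsupport, measureReal_pi_eq_ncard_mul_exp _
    (fun x hx j => bernDist_real_singleton (hz0 j) (hz1 j) (hx.2 j))
    fun x hx => hz _ (natCast_mem_polytope01_iff.mpr hx), ← numBinaryPoints_polytope01,
    mul_left_comm, ← bernoulliEntropy, ← Real.exp_add, add_neg_cancel, Real.exp_zero, mul_one]

end MaximumEntropy

/-! ### Counting tables -/

section Tables

open Filter

variable {ν : ℕ}

lemma exp_mul_div_gaussianFormula_tableMatrix {k : Fin ν → ℕ} (hk : ∀ i, 0 < k i) (S q : ℝ)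
    (w : Cell k → ℝ) :
    Real.exp S * q / gaussianFormula (tableMatrix k) S w = q * gaussianNorm (tableMatrix k) w := by
  rw [gaussianFormula, covolume_imageLattice_tableMatrix hk, mul_one, ← gaussianNorm,
    div_div_eq_mul_div, mul_assoc, mul_div_cancel_left₀ _ (Real.exp_ne_zero S)]

lemma isNearGaussian_geomDist_of_mem_Icc {δ M x : ℝ} (hδ : 0 < δ) (hx : δ ≤ x ∧ x ≤ M) :
    IsNearGaussian (geomDist x) x (x ^ 2 + x) ((δ ^ 2 + δ) / (1 + 4 * (δ ^ 2 + δ)))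
      (Real.exp ((M ^ 2 + M) / 2) * cubicConst M) := by
  have hx0 : 0 < x := hδ.trans_le hx.1
  have hw : δ ^ 2 + δ ≤ x ^ 2 + x := by gcongr <;> exact hx.1
  refine (isNearGaussian_geomDist hx0).mono ?_ ?_
  · rw [div_le_div_iff₀ (by positivity) (by positivity)]
    linarith
  · have hcubic := cubicConst_le_cubicConst hx0.le hx.2
    have hcubic0 := cubicConst_nonneg hx0.le
    gcongr <;> exact hx.2

theorem eventually_abs_numIntegerPoints_div_gaussianInteger_sub_one_le (hν : 5 ≤ ν) {c δ ε : ℝ}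
    (C M : ℝ) (hc : 0 < c) (hδ : 0 < δ) (hε : 0 < ε) :
    ∀ᶠ n : ℕ in atTop, ∀ k : Fin ν → ℕ, (∀ i, 0 < k i) →
      (∀ i, c * n ≤ k i ∧ (k i : ℝ) ≤ C * n) → ∀ b, ∀ z ∈ polytope (tableMatrix k) b,
      IsStationaryOn (polytope (tableMatrix k) b) (fun p => Real.log ((1 + z p) / z p)) z →
      (∀ p, δ ≤ z p ∧ z p ≤ M) →
      |(numIntegerPoints (polytope (tableMatrix k) b) : ℝ) / gaussianInteger (tableMatrix k) z
        - 1| ≤ ε := by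
  filter_upwards [eventually_abs_measureReal_table_mul_gaussianNorm_sub_one_le hν C
    (|M| ^ 2 + |M|) hc (w₀ := δ ^ 2 + δ) (by positivity)
    (κ := (δ ^ 2 + δ) / (1 + 4 * (δ ^ 2 + δ))) (by positivity)
    (mul_nonneg (Real.exp_nonneg ((|M| ^ 2 + |M|) / 2)) (cubicConst_nonneg (abs_nonneg M))) hε]
    with n hn k hk hkn b z hz hstat hzb
  have hbound (p : Cell k) : δ ≤ z p ∧ z p ≤ |M| :=
    ⟨(hzb p).1, (hzb p).2.trans (le_abs_self M)⟩
  have hz0 (p : Cell k) : 0 < z p := hδ.trans_le (hzb p).1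
  rw [numIntegerPoints_eq_exp_geomEntropy_mul hz0 hstat, gaussianInteger,
    exp_mul_div_gaussianFormula_tableMatrix hk]
  refine hn k hk hkn _ inferInstance z _ (fun p => ?_)
    (fun p => isNearGaussian_geomDist_of_mem_Icc hδ (hbound p)) b hz.1
  have hp0 := (hz0 p).le
  constructor <;> gcongr <;> first | exact (hbound p).1 | exact (hbound p).2

theorem eventually_abs_numBinaryPoints_div_gaussianBinary_sub_one_le (hν : 5 ≤ ν) {c δ ε : ℝ}
    (C : ℝ) (hc : 0 < c) (hδ : 0 < δ) (hε : 0 < ε) :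
    ∀ᶠ n : ℕ in atTop, ∀ k : Fin ν → ℕ, (∀ i, 0 < k i) →
      (∀ i, c * n ≤ k i ∧ (k i : ℝ) ≤ C * n) → ∀ b, ∀ z ∈ polytope01 (tableMatrix k) b,
      IsStationaryOn (polytope01 (tableMatrix k) b) (fun p => Real.log ((1 - z p) / z p)) z →
      (∀ p, δ ≤ z p ∧ z p ≤ 1 - δ) →
      |(numBinaryPoints (polytope01 (tableMatrix k) b) : ℝ) / gaussianBinary (tableMatrix k) z
        - 1| ≤ ε := by
  filter_upwards [eventually_abs_measureReal_table_mul_gaussianNorm_sub_one_le hν C 1 hc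
    (pow_pos hδ 2) (pow_pos hδ 2) (cubicConst_nonneg zero_le_one) hε]
    with n hn k hk hkn b z hz hstat hzb
  have hz0 (p : Cell k) : 0 < z p := hδ.trans_le (hzb p).1
  have hz1 (p : Cell k) : z p < 1 := by linarith [(hzb p).2]
  have hvar (p : Cell k) : δ ^ 2 ≤ z p - z p ^ 2 := by nlinarith [hzb p]
  rw [numBinaryPoints_eq_exp_bernoulliEntropy_mul hz0 hz1 hstat, gaussianBinary,
    exp_mul_div_gaussianFormula_tableMatrix hk]
  refine hn k hk hkn _ inferInstance z _ (fun p => ⟨hvar p, ?_⟩) (fun p => ?_) b hz.1.1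
  · linarith [hz1 p, sq_nonneg (z p)]
  · exact (isNearGaussian_bernDist (hz0 p).le (hz1 p).le).mono (hvar p)
      (cubicConst_le_cubicConst (hz0 p).le (hz1 p).le)

end Tables

section ConstantTable

lemma exp_geomEntropy_const {J : Type} [Fintype J] {α : ℝ} (hα : 0 < α) :
    Real.exp (geomEntropy fun _ : J => α) =
      ((α + 1) ^ (α + 1) * α ^ (-α)) ^ Fintype.card J := by
  rw [Real.rpow_def_of_pos hα, Real.rpow_def_of_pos (by positivity), ← Real.exp_add,
    ← Real.exp_nat_mul, geomEntropy, Finset.sum_const, Finset.card_univ, nsmul_eq_mul]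
  ring_nf

lemma exp_bernoulliEntropy_const {J : Type} [Fintype J] {α : ℝ} (hα : 0 < α) (hα1 : α < 1) :
    Real.exp (bernoulliEntropy fun _ : J => α) =
      (α ^ α * (1 - α) ^ (1 - α)) ^ (-(Fintype.card J : ℝ)) := by
  rw [Real.rpow_def_of_pos hα, Real.rpow_def_of_pos (sub_pos.mpr hα1), ← Real.exp_add,
    ← Real.exp_mul, bernoulliEntropy, Finset.sum_const, Finset.card_univ, nsmul_eq_mul, one_div,
    one_div, Real.log_inv, Real.log_inv]
  ring_nf

variable {ν : ℕ} {k : Fin ν → ℕ}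

lemma const_mem_transportPolytope (hk : ∀ i, 0 < k i) {β : (i : Fin ν) → Fin (k i) → ℕ} {N : ℕ}
    {α : ℝ} (hα : 0 ≤ α) (hN : Fintype.card (Cell k) * α = N)
    (hβ : ∀ i j, β i j * k i = N) : (fun _ => α) ∈ transportPolytope k β N := by
  refine ⟨funext fun e => ?_, fun _ => hα⟩
  simp only [mulVec, dotProduct, map_apply, ← Finset.sum_mul]
  rcases e with _ | ⟨i, j⟩
  · simpa [tableMatrix, tableRhs] using hN
  · have hki : (k i : ℝ) ≠ 0 := Nat.cast_ne_zero.mpr (hk i).ne'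
    have hrow : (∑ p, (tableMatrix k (some ⟨i, j⟩) p : ℝ)) * k i = Fintype.card (Cell k) := by
      exact_mod_cast sum_tableMatrix_some hk i j
    refine mul_right_cancel₀ hki ?_
    rw [mul_right_comm, hrow, hN, tableRhs]
    exact_mod_cast (hβ i _).symm

lemma isStationaryOn_const_table {P : Set (Cell k → ℝ)} {b : Constraint k → ℤ} {α : ℝ}
    (hP : P ⊆ polytope (tableMatrix k) b) (hα : (fun _ => α) ∈ P) (v : ℝ) :
    IsStationaryOn P (fun _ => v) fun _ => α := by
  have hsum {x : Cell k → ℝ} (hx : x ∈ P) : ∑ p, x p = b none := by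
    simpa [mulVec, dotProduct, tableMatrix] using congrFun (hP hx).1 none
  intro x hx
  rw [← Finset.sum_mul, Finset.sum_sub_distrib, hsum hx, hsum hα, sub_self, zero_mul]

end ConstantTable

section EqualSides

open Filter

variable {ν : ℕ}

lemma card_cell_const (n : ℕ) : Fintype.card (Cell fun _ : Fin ν => n) = n ^ ν := by simp

lemma weightedMatrix_const_mul_transpose {D J : Type} [Fintype J] (A : Matrix D J ℤ) {w : ℝ}
    (hw : 0 ≤ w) :
    weightedMatrix A (fun _ => w) * (weightedMatrix A fun _ => w)ᵀ =
      w • (A * Aᵀ).map (Int.cast : ℤ → ℝ) := by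
  ext c c'
  simp only [mul_apply, transpose_apply, weightedMatrix, of_apply, Matrix.smul_apply, map_apply,
    smul_eq_mul, Int.cast_sum, Int.cast_mul, Finset.mul_sum]
  refine Finset.sum_congr rfl fun p _ => ?_
  rw [mul_mul_mul_comm, Real.mul_self_sqrt hw]

lemma gaussianNorm_tableMatrix_const {n : ℕ} (hn : 0 < n) {w : ℝ} (hw : 0 ≤ w) :
    gaussianNorm (tableMatrix fun _ : Fin ν => n) (fun _ => w) =
      (2 * Real.pi * w) ^ (((n : ℝ) * ν - ν + 1) / 2) *
        (n : ℝ) ^ (((ν : ℝ) ^ 2 - ν) * ((n : ℝ) - 1) / 2) := by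
  have hd : (Fintype.card (Constraint fun _ : Fin ν => n) : ℝ) = n * ν - ν + 1 := by
    rw [card_constraint_cast fun _ => hn, Finset.sum_const, Finset.card_univ, Fintype.card_fin,
      nsmul_eq_mul]
    ring
  have hexp : (((ν ^ 2 - ν) * (n - 1) : ℕ) : ℝ) = ((ν : ℝ) ^ 2 - ν) * (n - 1) := by
    rw [Nat.cast_mul, Nat.cast_sub (Nat.le_self_pow two_ne_zero ν), Nat.cast_sub hn, Nat.cast_pow,
      Nat.cast_one]
  have hdet : (weightedMatrix (tableMatrix fun _ : Fin ν => n) (fun _ => w) *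
      (weightedMatrix (tableMatrix fun _ : Fin ν => n) fun _ => w)ᵀ).det =
      w ^ ((n : ℝ) * ν - ν + 1) * (n : ℝ) ^ (((ν : ℝ) ^ 2 - ν) * (n - 1)) := by
    rw [weightedMatrix_const_mul_transpose _ hw, det_smul, ← Int.cast_det,
      det_tableMatrix_mul_transpose_const hn, ← hd, ← hexp, Real.rpow_natCast, Real.rpow_natCast,
      Int.cast_pow, Int.cast_natCast]
  have hn0 : (0 : ℝ) ≤ n := n.cast_nonneg
  have h2pi : 0 ≤ 2 * Real.pi := by positivity
  rw [gaussianNorm, hdet, hd, Real.sqrt_eq_rpow, Real.mul_rpow h2pi hw,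
    Real.mul_rpow (Real.rpow_nonneg hw _) (Real.rpow_nonneg hn0 _), ← Real.rpow_mul hw,
    ← Real.rpow_mul hn0]
  ring_nf

lemma gaussianFormula_tableMatrix_const {n : ℕ} (hn : 0 < n) (S : ℝ) {w : ℝ} (hw : 0 ≤ w) :
    gaussianFormula (tableMatrix fun _ : Fin ν => n) S (fun _ => w) =
      Real.exp S * (2 * Real.pi * w) ^ (-((n : ℝ) * ν - ν + 1) / 2) *
        (n : ℝ) ^ (((ν : ℝ) - (ν : ℝ) ^ 2) * ((n : ℝ) - 1) / 2) := by
  rw [gaussianFormula, ← gaussianNorm, covolume_imageLattice_tableMatrix fun _ => hn, mul_one,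
    gaussianNorm_tableMatrix_const hn hw, div_eq_mul_inv, mul_inv, ← Real.rpow_neg (by positivity),
    ← Real.rpow_neg n.cast_nonneg]
  ring_nf

lemma const_mem_transportPolytope_const {n r : ℕ} (hν : 0 < ν) (hn : 0 < n) {α : ℝ} (hα : 0 ≤ α)
    (hr : (r : ℝ) = α * (n : ℝ) ^ (ν - 1)) :
    (fun _ => α) ∈ transportPolytope (fun _ : Fin ν => n) (fun _ _ => r) (n * r) := by
  refine const_mem_transportPolytope (fun _ => hn) hα ?_ fun _ _ => mul_comm r n
  rw [Nat.cast_mul, hr, card_cell_cast, Finset.prod_const, Finset.card_univ, Fintype.card_fin,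
    ← mul_pow_sub_one hν.ne']
  ring

theorem eventually_abs_numIntegerPoints_equalSides_div_sub_one_le (hν : 5 ≤ ν) {a ε : ℝ} (b : ℝ)
    (ha : 0 < a) (hε : 0 < ε) :
    ∀ᶠ k : ℕ in atTop, ∀ (α : ℝ) (r : ℕ), a ≤ α → α ≤ b → (r : ℝ) = α * (k : ℝ) ^ (ν - 1) →
      |(numIntegerPoints (transportPolytope (fun _ : Fin ν => k) (fun _ _ => r) (k * r)) : ℝ)
          / (((α + 1) ^ (α + 1) * α ^ (-α)) ^ (k ^ ν)
            * (2 * Real.pi * α ^ 2 + 2 * Real.pi * α) ^ (-((k : ℝ) * ν - ν + 1) / 2)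
            * (k : ℝ) ^ (((ν : ℝ) - (ν : ℝ) ^ 2) * ((k : ℝ) - 1) / 2)) - 1| ≤ ε := by
  filter_upwards [eventually_gt_atTop 0,
    eventually_abs_numIntegerPoints_div_gaussianInteger_sub_one_le hν 1 b one_pos ha hε]
    with k hk hcount α r haα hαb hr
  have hα : 0 < α := ha.trans_le haα
  have hz := const_mem_transportPolytope_const (by lia) hk hα.le hr
  have h := hcount (fun _ => k) (fun _ => hk) (by simp) _ _ hz
    (isStationaryOn_const_table subset_rfl hz _) fun _ => ⟨haα, hαb⟩
  rwa [gaussianInteger, gaussianFormula_tableMatrix_const hk _ (by positivity),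
    exp_geomEntropy_const hα, mul_add, card_cell_const] at h

theorem eventually_abs_numBinaryPoints_equalSides_div_sub_one_le (hν : 5 ≤ ν) {a b ε : ℝ}
    (ha : 0 < a) (hb : b < 1) (hε : 0 < ε) :
    ∀ᶠ k : ℕ in atTop, ∀ (α : ℝ) (r : ℕ), a ≤ α → α ≤ b → (r : ℝ) = α * (k : ℝ) ^ (ν - 1) →
      |(numBinaryPoints (transportPolytope01 (fun _ : Fin ν => k) (fun _ _ => r) (k * r)) : ℝ)
          / ((α ^ α * (1 - α) ^ (1 - α)) ^ (-((k : ℝ) ^ ν))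
            * (2 * Real.pi * α - 2 * Real.pi * α ^ 2) ^ (-((k : ℝ) * ν - ν + 1) / 2)
            * (k : ℝ) ^ (((ν : ℝ) - (ν : ℝ) ^ 2) * ((k : ℝ) - 1) / 2)) - 1| ≤ ε := by
  filter_upwards [eventually_gt_atTop 0,
    eventually_abs_numBinaryPoints_div_gaussianBinary_sub_one_le hν 1 one_pos
      (lt_min ha (sub_pos.mpr hb)) hε] with k hk hcount α r haα hαb hr
  have hα : 0 < α := ha.trans_le haα
  have hα1 : α < 1 := hαb.trans_lt hb
  have hz := const_mem_transportPolytope_const (by lia) hk hα.le hr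
  have hz1 : (fun _ => α) ∈ transportPolytope01 (fun _ : Fin ν => k) (fun _ _ => r) (k * r) :=
    ⟨hz, fun _ => hα1.le⟩
  have h := hcount (fun _ => k) (fun _ => hk) (by simp) _ _ hz1
    (isStationaryOn_const_table (fun _ hx => hx.1) hz1 _) fun _ =>
      ⟨(min_le_left _ _).trans haα, by linarith [min_le_right a (1 - b)]⟩
  rwa [gaussianBinary, gaussianFormula_tableMatrix_const hk _ (by nlinarith),
    exp_bernoulliEntropy_const hα hα1, mul_sub, card_cell_const, Nat.cast_pow] at h

end EqualSides

theorem mainTheorem9 (ν : ℕ) (hν : 2 ≤ ν) :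
    -- the determinant of `A Aᵀ` for `k × … × k` tables
    (∀ k : ℕ, 1 < k →
      (tableMatrix (fun _ : Fin ν => k) * (tableMatrix (fun _ : Fin ν => k))ᵀ).det
        = (k : ℤ) ^ ((ν ^ 2 - ν) * (k - 1))) ∧
    (5 ≤ ν →
      -- nonnegative integer tables
      (∀ c C δ M ε : ℝ, 0 < c → 0 < δ → 0 < ε → ∃ n₀ : ℕ, ∀ n : ℕ, n₀ ≤ n →
        ∀ k : Fin ν → ℕ, (∀ i, 1 < k i) → (∀ i, c * n ≤ k i ∧ (k i : ℝ) ≤ C * n) →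
        ∀ (β : (i : Fin ν) → Fin (k i) → ℕ) (N : ℕ),
          (∀ i j, 0 < β i j) → (∀ i, ∑ j, β i j = N) →
        ∀ z ∈ transportPolytope k β N,
          IsMaxOn geomEntropy (transportPolytope k β N) z →
          (∀ p, δ ≤ z p ∧ z p ≤ M) →
          |(numIntegerPoints (transportPolytope k β N) : ℝ)
              / gaussianInteger (tableMatrix k) z - 1| ≤ ε) ∧
      -- binary tables
      (∀ c C δ ε : ℝ, 0 < c → 0 < δ → δ < 1 / 2 → 0 < ε → ∃ n₀ : ℕ, ∀ n : ℕ, n₀ ≤ n →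
        ∀ k : Fin ν → ℕ, (∀ i, 1 < k i) → (∀ i, c * n ≤ k i ∧ (k i : ℝ) ≤ C * n) →
        ∀ (β : (i : Fin ν) → Fin (k i) → ℕ) (N : ℕ),
          (∀ i j, 0 < β i j) → (∀ i, ∑ j, β i j = N) →
        ∀ z ∈ transportPolytope01 k β N,
          IsMaxOn bernoulliEntropy (transportPolytope01 k β N) z →
          (∀ p, δ ≤ z p ∧ z p ≤ 1 - δ) →
          |(numBinaryPoints (transportPolytope01 k β N) : ℝ)
              / gaussianBinary (tableMatrix k) z - 1| ≤ ε) ∧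
      -- `k × … × k` nonnegative integer tables with all sectional sums `r = α k ^ (ν - 1)`
      (∀ a b ε : ℝ, 0 < a → 0 < ε → ∃ k₀ : ℕ, ∀ k : ℕ, k₀ ≤ k →
        ∀ (α : ℝ) (r : ℕ), a ≤ α → α ≤ b → (r : ℝ) = α * (k : ℝ) ^ (ν - 1) →
          |(numIntegerPoints
                (transportPolytope (fun _ : Fin ν => k) (fun _ _ => r) (k * r)) : ℝ)
              / (((α + 1) ^ (α + 1) * α ^ (-α)) ^ (k ^ ν)
                * (2 * Real.pi * α ^ 2 + 2 * Real.pi * α) ^ (-((k : ℝ) * ν - ν + 1) / 2)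
                * (k : ℝ) ^ (((ν : ℝ) - (ν : ℝ) ^ 2) * ((k : ℝ) - 1) / 2)) - 1| ≤ ε) ∧
      -- `k × … × k` binary tables with all sectional sums `r = α k ^ (ν - 1)`
      (∀ a b ε : ℝ, 0 < a → b < 1 → 0 < ε → ∃ k₀ : ℕ, ∀ k : ℕ, k₀ ≤ k →
        ∀ (α : ℝ) (r : ℕ), a ≤ α → α ≤ b → (r : ℝ) = α * (k : ℝ) ^ (ν - 1) →
          |(numBinaryPoints
                (transportPolytope01 (fun _ : Fin ν => k) (fun _ _ => r) (k * r)) : ℝ)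
              / ((α ^ α * (1 - α) ^ (1 - α)) ^ (-((k : ℝ) ^ ν))
                * (2 * Real.pi * α - 2 * Real.pi * α ^ 2) ^ (-((k : ℝ) * ν - ν + 1) / 2)
                * (k : ℝ) ^ (((ν : ℝ) - (ν : ℝ) ^ 2) * ((k : ℝ) - 1) / 2)) - 1| ≤ ε)) := by
  refine ⟨fun k hk => det_tableMatrix_mul_transpose_const (zero_lt_one.trans hk),
    fun hν5 => ⟨?_, ?_, ?_, ?_⟩⟩
  · intro c C δ M ε hc hδ hε
    obtain ⟨n₀, hn₀⟩ := Filter.eventually_atTop.mp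
      (eventually_abs_numIntegerPoints_div_gaussianInteger_sub_one_le hν5 C M hc hδ hε)
    refine ⟨n₀, fun n hn k hk hkn β N _ _ z hz hmax hzb => ?_⟩
    have hz0 (p : Cell k) : 0 < z p := hδ.trans_le (hzb p).1
    exact hn₀ n hn k (fun i => zero_lt_one.trans (hk i)) hkn _ z hz
      (isStationaryOn_of_isMaxOn_geomEntropy hz hz0 hmax) hzb
  · intro c C δ ε hc hδ _ hε
    obtain ⟨n₀, hn₀⟩ := Filter.eventually_atTop.mp
      (eventually_abs_numBinaryPoints_div_gaussianBinary_sub_one_le hν5 C hc hδ hε)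
    refine ⟨n₀, fun n hn k hk hkn β N _ _ z hz hmax hzb => ?_⟩
    have hz0 (p : Cell k) : 0 < z p := hδ.trans_le (hzb p).1
    have hz1 (p : Cell k) : z p < 1 := (hzb p).2.trans_lt (sub_lt_self 1 hδ)
    exact hn₀ n hn k (fun i => zero_lt_one.trans (hk i)) hkn _ z hz
      (isStationaryOn_of_isMaxOn_bernoulliEntropy hz hz0 hz1 hmax) hzb
  · exact fun a b ε ha hε => Filter.eventually_atTop.mp
      (eventually_abs_numIntegerPoints_equalSides_div_sub_one_le hν5 b ha hε)
  · exact fun a b ε ha hb hε => Filter.eventually_atTop.mp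
      (eventually_abs_numBinaryPoints_equalSides_div_sub_one_le hν5 ha hb hε)
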